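/- Let $\mathbf k$ be an algebraically closed field of characteristic zero, let $1\le p<n$ be integers with $p$ coprime to $n$, and let $\mathfrak g=\mathfrak{sl}_n(\mathbf k)$ with simple roots $\pi=\{\alpha_1,\dots,\alpha_{n-1}\}$, $\alpha_l=\varepsilon_l-\varepsilon_{l+1}$, and root vectors $x_{\varepsilon_i-\varepsilon_j}$ the matrix units $x_{i,j}$. Put $\pi^+=\pi$ and $\pi^-=\pi\setminus\{\alpha_p\}$. Let $\mathfrak q\subset\mathfrak g$ be the standard parabolic subalgebra whose roots are the negative roots together with the roots in $\mathbb Z\pi^-$ (the biparabolic of type $(\pi^+,\pi^-)$), and let $\mathfrak q_\Lambda$ be its canonical truncation, that is, the common kernel of the weights of all semi-invariants of the adjoint action of $\mathfrak q$ on $S(\mathfrak q)$. (These are the truncated biparabolics of index one.) Let $\rho:\mathfrak g^*\to\mathfrak q_\Lambda^*$ be the restriction map; elements of $\mathfrak g$ are viewed in $\mathfrak g^*$, and by restriction in $\mathfrak q_\Lambda^*$, through the Killing form. Let $\mathscr N(\mathfrak g)_{reg}\subset\mathfrak g^*$ be the set of common zeros of the homogeneous invariants of positive degree in $S(\mathfrak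 g)$ whose coadjoint stabilizer has the minimal possible dimension. Let $\mathscr K=\{\varepsilon_i-\varepsilon_{n+1-i}: i<n+1-i\}$ and $\mathscr K'=\{\varepsilon_i-\varepsilon_{p+1-i}: 1\le i<p+1-i\}\cup\{\varepsilon_i-\varepsilon_{n+p+1-i}: p<i<n+p+1-i\}$ be the Kostant cascades of $\pi$ and $\pi^-$. Then exactly one root of $\mathscr K\cup(-\mathscr K')$ lies in $\pi\cup(-\pi)$. Denote it by $\epsilon_s\beta_s$, let $\eta$ be the sum of the $x_\gamma$ over all other $\gamma\in\mathscr K\cup(-\mathscr K')$, and let $\mathscr W=\eta+\mathbf k\,x_{\epsilon_s\beta_s}\subset\mathfrak q_\Lambda^*$ (the Weierstrass section). There is a (Zariski closed) one-dimensional subvariety $Z$ of $\mathscr N(\mathfrak g)_{reg}$ which $\rho$ maps bijectively onto $\mathscr W$, and such that: - if $p\ne 1$ and $p\neq n-1$, then $Z$ is irreducible; - if $p=1$ or $p=n-1$, then $Z=C\cup\{z\}$, where $C$ is an irreducible (closed) one-dimensional subvariety of $\mathscr N(\mathfrak g)_{reg}$ and $z\notin C$ is a point. -/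

import Mathlib

noncomputable section

namespace IndexOne

open LieAlgebra.SpecialLinear

section General

variable (k : Type*) [Field k] (a : Type*) [LieRing a] [LieAlgebra k a]

/-! ### The symmetric algebra `S(a)`, viewed as the polynomial functions on `a*` -/

/-- The value of the polynomial function `F ∈ S(a)` at the point `f ∈ a*`. -/
def evalAt (f : Module.Dual k a) : SymmetricAlgebra k a →ₐ[k] k :=
  SymmetricAlgebra.lift f

/-- The algebra map `S(a) → S(a)[ε]` with `x ↦ x + ε [u, x]` for `x ∈ a`; its `ε`-component is
the adjoint action of `u` on `S(a)`. -/
def adDual (u : a) : SymmetricAlgebra k a →ₐ[k] DualNumber (SymmetricAlgebra k a) :=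
  SymmetricAlgebra.lift
    ((TrivSqZeroExt.inlAlgHom k (SymmetricAlgebra k a) (SymmetricAlgebra k a)).toLinearMap ∘ₗ
        SymmetricAlgebra.ι k a +
      (TrivSqZeroExt.inrHom (SymmetricAlgebra k a) (SymmetricAlgebra k a)).restrictScalars k ∘ₗ
        SymmetricAlgebra.ι k a ∘ₗ LieAlgebra.ad k a u)

theorem fst_adDual (u : a) (F : SymmetricAlgebra k a) : (adDual k a u F).fst = F := by
  have h : (TrivSqZeroExt.fstHom k (SymmetricAlgebra k a) (SymmetricAlgebra k a)).comp
      (adDual k a u) = AlgHom.id k _ := by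
    apply SymmetricAlgebra.algHom_ext
    ext x
    simp [adDual]
  exact DFunLike.congr_fun h F

/-- The adjoint action of `u ∈ a` on `S(a)`: the derivation of `S(a)` extending `ad u`. -/
def adS (u : a) : Derivation k (SymmetricAlgebra k a) (SymmetricAlgebra k a) where
  toLinearMap := (TrivSqZeroExt.sndHom (SymmetricAlgebra k a)
    (SymmetricAlgebra k a)).restrictScalars k ∘ₗ (adDual k a u).toLinearMap
  map_one_eq_zero' := by simp
  leibniz' F G := by simp [fst_adDual, mul_comm G]

theorem adS_ι (u x : a) :
    adS k a u (SymmetricAlgebra.ι k a x) = SymmetricAlgebra.ι k a ⁅u, x⁆ := by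
  change (adDual k a u (SymmetricAlgebra.ι k a x)).snd = _
  simp [adDual]

theorem adS_lie (u v : a) (F : SymmetricAlgebra k a) :
    adS k a ⁅u, v⁆ F = adS k a u (adS k a v F) - adS k a v (adS k a u F) := by
  induction F using SymmetricAlgebra.induction with
  | algebraMap r => simp
  | ι x => simp [adS_ι, ← map_sub]
  | mul F G hF hG => simp [hF, hG]; ring
  | add F G hF hG => simp [hF, hG]; ring

/-- `Y(a)`: the invariants of `S(a)` under the adjoint action, that is, the invariant polynomial
functions on `a*`. -/
def invariants : Subalgebra k (SymmetricAlgebra k a) where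
  carrier := {F | ∀ u : a, adS k a u F = 0}
  mul_mem' hF hG u := by simp [hF u, hG u]
  add_mem' hF hG u := by simp [hF u, hG u]
  algebraMap_mem' r u := by simp

/-- The homogeneous component of degree `d` of `S(a)`. -/
def homogeneous (d : ℕ) : Submodule k (SymmetricAlgebra k a) :=
  LinearMap.range (SymmetricAlgebra.ι k a) ^ d

/-- The nullcone `N(a) ⊆ a*`: the zero locus of the homogeneous invariants of positive degree. -/
def nullcone : Set (Module.Dual k a) :=
  {f | ∀ d : ℕ, 0 < d → ∀ F ∈ invariants k a, F ∈ homogeneous k a d → evalAt k a f F = 0}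

/-- The stabilizer `a^f` of `f ∈ a*` for the coadjoint action. -/
def stabilizer (f : Module.Dual k a) : Submodule k a where
  carrier := {u | ∀ v : a, f ⁅u, v⁆ = 0}
  add_mem' hu hv w := by simp [hu w, hv w]
  zero_mem' w := by simp
  smul_mem' c u hu w := by simp [hu w]

/-- The regular elements of `a*`: those whose stabilizer has the minimal dimension. -/
def regularSet : Set (Module.Dual k a) :=
  {f | ∀ g : Module.Dual k a,
    Module.finrank k (stabilizer k a f) ≤ Module.finrank k (stabilizer k a g)}

/-- `N(a)_reg`. -/
def regNullcone : Set (Module.Dual k a) :=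
  nullcone k a ∩ regularSet k a

/-- `F` is a semi-invariant of `S(a)` of weight `χ`. -/
def IsSemiInvariant (χ : Module.Dual k a) (F : SymmetricAlgebra k a) : Prop :=
  F ≠ 0 ∧ ∀ u : a, adS k a u F = χ u • F

/-- The canonical truncation `a_Λ`: the common kernel of the weights of the semi-invariants
of `S(a)`. -/
def truncation : LieIdeal k a where
  carrier := {u | ∀ χ F, IsSemiInvariant k a χ F → χ u = 0}
  add_mem' hu hv χ F h := by simp [hu χ F h, hv χ F h]
  zero_mem' χ F _ := by simp
  smul_mem' c u hu χ F h := by simp [hu χ F h]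
  lie_mem := by
    intro u v _ χ F h
    have h1 := adS_lie k a u v F
    simp only [h.2, Derivation.map_smul, smul_smul, mul_comm (χ v), sub_self] at h1
    exact (smul_eq_zero.mp h1).resolve_right h.1

/-! ### The Zariski topology on `a*` -/

/-- The Zariski topology on the affine space `a*`, with basis the non-vanishing loci of
polynomial functions. -/
@[reducible] def zariski : TopologicalSpace (Module.Dual k a) :=
  TopologicalSpace.generateFrom {U | ∃ F : SymmetricAlgebra k a, U = {f | evalAt k a f F ≠ 0}}

/-- `Z` is a closed subvariety of the subset `X` of `a*`. -/
def IsSubvariety (X Z : Set (Module.Dual k a)) : Prop :=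
  ∃ T : Set (Module.Dual k a), @IsClosed _ (zariski k a) T ∧ Z = T ∩ X

/-- `Z` is irreducible (in particular non-empty). -/
def IsIrred (Z : Set (Module.Dual k a)) : Prop :=
  @IsIrreducible _ (zariski k a) Z

/-- The dimension of `Z` with its induced Zariski topology. -/
def dimension (Z : Set (Module.Dual k a)) : WithBot ℕ∞ :=
  @topologicalKrullDim Z (TopologicalSpace.induced Subtype.val (zariski k a))

end General

/-! ### Roots, cascades and biparabolics of `sl_n`

The indices `1, …, n` are represented by `Fin n`, shifted by one. The root `ε_i - ε_j` is the
pair `(i, j)` with `i ≠ j`. A set of simple roots is represented by the set of its labels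
`l ∈ {1, …, n - 1}`, where `α_l = ε_l - ε_{l+1}` in the usual numbering from `1` to `n`; thus
`ε_i - ε_j` with `i < j` in `Fin n` has support `{α_l : i < l ≤ j}`. -/

/-- The set `π` of all simple roots. -/
def simpleRoots (n : ℕ) : Set ℕ := Set.Ico 1 n

section Roots

variable {n : ℕ}

/-- The positive root `ε_i - ε_j` (`i < j`) belongs to `ℕ π'`. -/
def SupportedIn (π' : Set ℕ) (i j : Fin n) : Prop :=
  ∀ l : ℕ, (i : ℕ) < l → l ≤ (j : ℕ) → l ∈ π'

/-- `[r, s]` is a connected component of the partition of the indices defined by `π'`. -/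
def IsComponent (π' : Set ℕ) (r s : Fin n) : Prop :=
  r ≤ s ∧ SupportedIn π' r s ∧ (r : ℕ) ∉ π' ∧ (s : ℕ) + 1 ∉ π'

/-- The Kostant cascade of `π'`: the positive roots `ε_i - ε_j` where `i` and `j` are exchanged by
the reflection in the centre of a connected component. -/
def cascade (π' : Set ℕ) : Set (Fin n × Fin n) :=
  {γ | γ.1 < γ.2 ∧ ∃ r s : Fin n, IsComponent π' r s ∧ r ≤ γ.1 ∧ γ.2 ≤ s ∧
    (γ.1 : ℕ) + (γ.2 : ℕ) = (r : ℕ) + (s : ℕ)}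

/-- `𝒦 ∪ (-𝒦')`, where `𝒦` is the cascade of `πp` and `𝒦'` that of `πm`. -/
def cascadeRoots (πp πm : Set ℕ) : Set (Fin n × Fin n) :=
  cascade πp ∪ {γ | (γ.2, γ.1) ∈ cascade πm}

/-- The root `ε_i - ε_j` is in `π ∪ (-π)`. -/
def IsSimpleUpToSign (γ : Fin n × Fin n) : Prop :=
  (γ.1 : ℕ) + 1 = γ.2 ∨ (γ.2 : ℕ) + 1 = γ.1

/-- The exceptional value: a root of `π ∪ (-π)` lying in `𝒦 ∪ (-𝒦')`. -/
def IsExceptional (πp πm : Set ℕ) (γ : Fin n × Fin n) : Prop :=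
  γ ∈ cascadeRoots πp πm ∧ IsSimpleUpToSign γ

end Roots

section SpecialLinear

variable (k : Type*) [Field k] (n : ℕ)

/-- The subalgebra of `sl_n` of the matrices supported on a transitive relation. -/
def supportedSubalgebra (r : Fin n → Fin n → Prop)
    (htrans : ∀ i j l, r i j → r j l → r i l) : LieSubalgebra k (sl (Fin n) k) where
  carrier := {x | ∀ i j, ¬ r i j → x.val i j = 0}
  add_mem' hx hy i j h := by simp [hx i j h, hy i j h]
  zero_mem' i j _ := by simp
  smul_mem' c x hx i j h := by simp [hx i j h]
  lie_mem' := by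
    intro x y hx hy i j h
    have key : ∀ u v : Matrix (Fin n) (Fin n) k, (∀ i j, ¬ r i j → u i j = 0) →
        (∀ i j, ¬ r i j → v i j = 0) → (u * v) i j = 0 := by
      intro u v hu hv
      rw [Matrix.mul_apply]
      refine Finset.sum_eq_zero fun l _ => ?_
      by_cases h1 : r i l
      · rw [hv l j fun h2 => h (htrans i l j h1 h2), mul_zero]
      · rw [hu i l h1, zero_mul]
    rw [sl_bracket, Matrix.sub_apply, key _ _ hx hy, key _ _ hy hx, sub_zero]

/-- The standard parabolic `p⁻_{π'}`, with set of roots `Δ⁻ ∪ (Δ ∩ ℤ π')`. -/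
def negParabolic (π' : Set ℕ) : LieSubalgebra k (sl (Fin n) k) :=
  supportedSubalgebra k n (fun i j => j ≤ i ∨ SupportedIn π' i j) <| by
    intro i j l h1 h2
    by_cases h : l ≤ i
    · exact Or.inl h
    refine Or.inr fun t ht1 ht2 => ?_
    rw [Fin.le_def] at h h1 h2
    by_cases h3 : t ≤ (j : ℕ)
    · exact (h1.resolve_left (by omega)) t ht1 h3
    · exact (h2.resolve_left (by omega)) t (by omega) ht2

/-- The standard parabolic `p⁺_{π'}`, with set of roots `Δ⁺ ∪ (Δ ∩ ℤ π')`. -/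
def posParabolic (π' : Set ℕ) : LieSubalgebra k (sl (Fin n) k) :=
  supportedSubalgebra k n (fun i j => i ≤ j ∨ SupportedIn π' j i) <| by
    intro i j l h1 h2
    by_cases h : i ≤ l
    · exact Or.inl h
    refine Or.inr fun t ht1 ht2 => ?_
    rw [Fin.le_def] at h h1 h2
    by_cases h3 : t ≤ (j : ℕ)
    · exact (h2.resolve_left (by omega)) t ht1 h3
    · exact (h1.resolve_left (by omega)) t (by omega) ht2

/-- The biparabolic subalgebra `q` of type `(π⁺, π⁻) = (πp, πm)`, namely `p⁻_{π⁻} ∩ p⁺_{π⁺}`. Its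
dual is identified by the Killing form with the opposed subalgebra, whose roots are
`Δ ∩ (ℕ π⁺ ∪ -ℕ π⁻)`. -/
def biparabolic (πp πm : Set ℕ) : LieSubalgebra k (sl (Fin n) k) :=
  negParabolic k n πm ⊓ posParabolic k n πp

/-- The canonical truncation `q_Λ` of the biparabolic `q` of type `(π⁺, π⁻) = (πp, πm)`. -/
abbrev truncatedBiparabolic (πp πm : Set ℕ) : LieIdeal k (biparabolic k n πp πm) :=
  truncation k (biparabolic k n πp πm)

/-- The restriction map `ρ : g* → q_Λ*`. -/
def restriction (πp πm : Set ℕ) :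
    Module.Dual k (sl (Fin n) k) →ₗ[k] Module.Dual k (truncatedBiparabolic k n πp πm) :=
  Module.Dual.transpose ((biparabolic k n πp πm).toSubmodule.subtype ∘ₗ
    (truncatedBiparabolic k n πp πm).toSubmodule.subtype)

variable {n}

/-- The root vector `x_γ` of `sl_n`: the matrix unit `x_{i,j}` for `γ = ε_i - ε_j`. -/
def rootVector (γ : Fin n × Fin n) : sl (Fin n) k :=
  if h : γ.1 ≠ γ.2 then single γ.1 γ.2 h 1 else 0

open Classical in
/-- The element `Σ x_δ` of `sl_n`, the sum being over the `δ` in `𝒦 ∪ (-𝒦')` other than `γ`. -/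
def eta (πp πm : Set ℕ) (γ : Fin n × Fin n) : sl (Fin n) k :=
  ∑ δ : Fin n × Fin n with δ ∈ cascadeRoots πp πm ∧ δ ≠ γ, rootVector k δ

/-- The line `𝒲 = η + k x_γ` in `q_Λ*`, where elements of `sl_n` define linear forms on `q_Λ`
through the Killing form. -/
def weierstrassLine (πp πm : Set ℕ) (γ : Fin n × Fin n) :
    Set (Module.Dual k (truncatedBiparabolic k n πp πm)) :=
  Set.range fun c : k =>
    restriction k n πp πm (killingForm k (sl (Fin n) k) (eta k πp πm γ + c • rootVector k γ))

end SpecialLinear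

end IndexOne

end

/-!
The roots of `𝒦 ∪ (-𝒦')` are the oriented edges of the meander graph of the pair `(p, n - p)`, which
embeds into a path because `p` and `n` are coprime. Through the Killing form, a matrix that is
strictly triangular for some total order of the indices is a regular nilpotent element exactly when
its entries at successive indices are all non-zero. One chooses the total order so that any two
successive indices are joined by a non-exceptional meander edge or lead from the second block to the
first. In the latter case the corresponding matrix unit is orthogonal to `𝔮_Λ`; adding these matrix
units to the points of `𝒲` therefore does not change their restrictions. If both blocks have size at
least two, the order can be chosen to be compatible with the exceptional edge as well, and the
translate of `𝒲` is a line of regular nilpotent elements. If a block has size one, the meander graph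
is itself an oriented path: the points `η + c x_γ` are regular nilpotent for `c ≠ 0`, and only `η`
has to be corrected, which splits off one point.
-/

noncomputable section

namespace IndexOne

open LieAlgebra.SpecialLinear

section Killing

theorem trace_mulLeft_comp_mulRight {R ι : Type*} [CommRing R] [Fintype ι]
    (a b : Matrix ι ι R) :
    LinearMap.trace R (Matrix ι ι R) (LinearMap.mulLeft R a ∘ₗ LinearMap.mulRight R b) =
      a.trace * b.trace := by
  classical
  rw [LinearMap.trace_eq_matrix_trace R (Matrix.stdBasis R ι ι), Matrix.trace,
    Fintype.sum_prod_type, Matrix.trace, Matrix.trace, Finset.sum_mul_sum]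
  refine Finset.sum_congr rfl fun i _ => Finset.sum_congr rfl fun j _ => ?_
  rw [Matrix.diag_apply, LinearMap.toMatrix_apply, Matrix.stdBasis_eq_single]
  simp [Matrix.stdBasis, Matrix.mul_apply, Matrix.single_apply, ite_and]

variable {k : Type*} [Field k] {ι : Type*} [Fintype ι] [DecidableEq ι]

/-- The endomorphism `ad x ∘ ad y` of the space of all square matrices. -/
def adComp (x y : Matrix ι ι k) : Module.End k (Matrix ι ι k) :=
  (LinearMap.mulLeft k x - LinearMap.mulRight k x) ∘ₗ
    (LinearMap.mulLeft k y - LinearMap.mulRight k y)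

theorem trace_adComp (x y : Matrix ι ι k) :
    LinearMap.trace k _ (adComp x y) =
      2 * Fintype.card ι * (x * y).trace - 2 * x.trace * y.trace := by
  have expand : adComp x y =
      LinearMap.mulLeft k (x * y) ∘ₗ LinearMap.mulRight k 1
        - LinearMap.mulLeft k x ∘ₗ LinearMap.mulRight k y
        - LinearMap.mulLeft k y ∘ₗ LinearMap.mulRight k x
        + LinearMap.mulLeft k 1 ∘ₗ LinearMap.mulRight k (y * x) := by
    ext1 z
    simp only [adComp, LinearMap.add_apply, LinearMap.sub_apply, LinearMap.comp_apply,
      LinearMap.mulLeft_apply, LinearMap.mulRight_apply]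
    noncomm_ring
  rw [expand]
  simp only [map_add, map_sub, trace_mulLeft_comp_mulRight, Matrix.trace_one,
    Matrix.trace_mul_comm y]
  ring

theorem killingForm_sl (x y : sl ι k) :
    killingForm k (sl ι k) x y = 2 * Fintype.card ι * (x.val * y.val).trace := by
  let K : Submodule k (Matrix ι ι k) := LinearMap.ker (Matrix.traceLinearMap ι k k)
  have mapsTo : ∀ z, adComp x.val y.val z ∈ K := fun z => by
    change Matrix.trace (x.val * _ - _ * x.val) = 0
    rw [Matrix.trace_sub, Matrix.trace_mul_comm, sub_self]
  have trace_restrict := LinearMap.trace_restrict_eq_of_forall_mem K _ mapsTo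
  have hx : x.val.trace = 0 := x.2
  rw [trace_adComp, hx, mul_zero, zero_mul, sub_zero] at trace_restrict
  rw [killingForm_apply_apply, ← trace_restrict]
  rfl

variable [CharZero k]

theorem eq_zero_of_forall_trace_mul_eq_zero {x : sl ι k}
    (h : ∀ y : sl ι k, (x.val * y.val).trace = 0) : x = 0 := by
  have offDiag : ∀ i j, i ≠ j → x.val i j = 0 := fun i j hij => by
    simpa [Matrix.trace_mul_single] using h (single j i hij.symm 1)
  have diag : ∀ i j, x.val i i = x.val j j := fun i j => by
    have := h (singleSubSingle i j 1)
    rw [val_singleSubSingle, mul_sub, Matrix.trace_sub] at this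
    simpa [Matrix.trace_mul_single, sub_eq_zero] using this
  ext i j
  obtain rfl | hij := eq_or_ne i j
  · have hx : x.val.trace = 0 := x.2
    have : Nonempty ι := ⟨i⟩
    simpa [Matrix.trace, Matrix.diag_apply, fun j => diag j i] using hx
  · exact offDiag i j hij

theorem killingForm_sl_injective : Function.Injective (killingForm k (sl ι k)) := by
  rw [injective_iff_map_eq_zero]
  intro x hx
  obtain hι | hι := isEmpty_or_nonempty ι
  · exact Subtype.ext (Subsingleton.elim _ _)
  refine eq_zero_of_forall_trace_mul_eq_zero fun y => ?_
  have := LinearMap.congr_fun hx y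
  rw [killingForm_sl] at this
  simpa using this

theorem killingForm_sl_surjective : Function.Surjective (killingForm k (sl ι k)) :=
  (LinearMap.injective_iff_surjective_of_finrank_eq_finrank
    (Subspace.dual_finrank_eq (K := k) (V := sl ι k)).symm).mp killingForm_sl_injective

theorem mem_stabilizer_killingForm {x u : sl ι k} :
    u ∈ stabilizer k (sl ι k) (killingForm k (sl ι k) x) ↔ Commute x.val u.val := by
  have invariant (v : sl ι k) : killingForm k (sl ι k) ⁅x, u⁆ v = killingForm k (sl ι k) x ⁅u, v⁆ :=
    LieModule.traceForm_apply_lie_apply k _ _ x u v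
  calc u ∈ stabilizer k (sl ι k) (killingForm k (sl ι k) x)
      ↔ killingForm k (sl ι k) ⁅x, u⁆ = 0 := by
        rw [LinearMap.ext_iff]
        exact forall_congr' fun v => by rw [invariant]; rfl
    _ ↔ Commute x.val u.val := by
        rw [(injective_iff_map_eq_zero' _).mp killingForm_sl_injective, Subtype.ext_iff,
          sl_bracket, ZeroMemClass.coe_zero, sub_eq_zero, commute_iff_eq]

end Killing

section Curve

open Polynomial

variable {k : Type*} [Field k] {a : Type*} [LieRing a] [LieAlgebra k a]

/-- The point at parameter `c` of the polynomial curve in `a*` whose coordinate functions are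
given by `φ`. -/
def curveAt (φ : a →ₗ[k] k[X]) (c : k) : Module.Dual k a := leval c ∘ₗ φ

theorem eval_lift_eq_evalAt (φ : a →ₗ[k] k[X]) (c : k) (F : SymmetricAlgebra k a) :
    (SymmetricAlgebra.lift φ F).eval c = evalAt k a (curveAt φ c) F := by
  have : (aeval c).comp (SymmetricAlgebra.lift φ) = evalAt k a (curveAt φ c) := by
    apply SymmetricAlgebra.algHom_ext
    ext y
    simp [evalAt, curveAt, coe_aeval_eq_eval]
  simpa [coe_aeval_eq_eval] using DFunLike.congr_fun this F

theorem evalAt_zero_of_mem_homogeneous {d : ℕ} (hd : d ≠ 0) {F : SymmetricAlgebra k a}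
    (hF : F ∈ homogeneous k a d) : evalAt k a 0 F = 0 := by
  obtain ⟨e, rfl⟩ := Nat.exists_eq_succ_of_ne_zero hd
  rw [homogeneous, pow_succ] at hF
  induction hF using Submodule.mul_induction_on' with
  | mem_mul_mem x _ y hy =>
    obtain ⟨y, rfl⟩ := hy
    rw [map_mul, evalAt, SymmetricAlgebra.lift_ι_apply, LinearMap.zero_apply, mul_zero]
  | add x _ y _ ihx ihy => rw [map_add, ihx, ihy, add_zero]

theorem lift_adS_eq_X_mul_derivative {φ : a →ₗ[k] k[X]} {h : a}
    (hφ : ∀ y, φ ⁅h, y⁆ = X * derivative (φ y)) (F : SymmetricAlgebra k a) :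
    SymmetricAlgebra.lift φ (adS k a h F) = X * derivative (SymmetricAlgebra.lift φ F) := by
  induction F using SymmetricAlgebra.induction with
  | algebraMap r => simp
  | ι y => rw [adS_ι, SymmetricAlgebra.lift_ι_apply, SymmetricAlgebra.lift_ι_apply, hφ]
  | mul F G hF hG =>
    rw [Derivation.leibniz, map_add, smul_eq_mul, smul_eq_mul, map_mul, map_mul, hF, hG, map_mul,
      derivative_mul]
    ring
  | add F G hF hG => rw [map_add, map_add, hF, hG, map_add, derivative_add, mul_add]

/-- The flow of `h` contracts the curve to the origin, and invariants are constant along it. -/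
theorem curveAt_one_mem_nullcone [CharZero k] {φ : a →ₗ[k] k[X]} {h : a}
    (hφ : ∀ y, φ ⁅h, y⁆ = X * derivative (φ y)) (hφ0 : curveAt φ 0 = 0) :
    curveAt φ 1 ∈ nullcone k a := by
  intro d hd F hF hFd
  have derivative_eq_zero : derivative (SymmetricAlgebra.lift φ F) = 0 := by
    have := lift_adS_eq_X_mul_derivative hφ F
    rw [hF, map_zero] at this
    exact (mul_eq_zero.mp this.symm).resolve_left X_ne_zero
  calc evalAt k a (curveAt φ 1) F
      = (SymmetricAlgebra.lift φ F).eval 1 := (eval_lift_eq_evalAt φ 1 F).symm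
    _ = (SymmetricAlgebra.lift φ F).eval 0 := by
        rw [eq_C_of_derivative_eq_zero derivative_eq_zero, eval_C, eval_C]
    _ = evalAt k a 0 F := by rw [eval_lift_eq_evalAt, hφ0]
    _ = 0 := evalAt_zero_of_mem_homogeneous hd.ne' hFd

end Curve

section Nullcone

open Polynomial

variable {k : Type*} [Field k] {ι : Type*} [Fintype ι] [DecidableEq ι]

variable (k) in
/-- The diagonal matrix with entries `w`, shifted by a scalar matrix to have trace zero. -/
def diagTraceless [CharZero k] (w : ι → ℕ) : sl ι k :=
  ⟨Matrix.diagonal fun i => (w i : k) - (∑ j, (w j : k)) / Fintype.card ι, by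
    change Matrix.trace _ = 0
    obtain hι | hι := isEmpty_or_nonempty ι
    · exact Matrix.trace_eq_zero_of_isEmpty _
    · rw [Matrix.trace_diagonal, Finset.sum_sub_distrib, Finset.sum_const, Finset.card_univ,
        nsmul_eq_mul, mul_div_cancel₀ _ (Nat.cast_ne_zero.mpr Fintype.card_ne_zero), sub_self]⟩

theorem lie_diagTraceless_apply [CharZero k] (w : ι → ℕ) (y : sl ι k) (i j : ι) :
    (⁅diagTraceless k w, y⁆ : sl ι k).val i j = ((w i : k) - w j) * y.val i j := by
  rw [sl_bracket, Matrix.sub_apply, diagTraceless, Matrix.diagonal_mul, Matrix.mul_diagonal]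
  ring

/-- The curve `c ↦ Ad(c ^ w) x` in the dual of `sl`, where `c ^ w` is the diagonal matrix with
entries `c ^ w i` and `x` raises the weight `w`; the `(i, j)`-entry of `x` gets scaled by
`c ^ (w j - w i)`. -/
def scaledForm (x : sl ι k) (w : ι → ℕ) : sl ι k →ₗ[k] k[X] where
  toFun y := ∑ i, ∑ j, monomial (w j - w i) (2 * Fintype.card ι * (x.val i j * y.val j i))
  map_add' y z := by
    simp only [← Finset.sum_add_distrib, ← map_add, ← mul_add]
    rfl
  map_smul' c y := by
    simp only [Finset.smul_sum, smul_monomial, RingHom.id_apply, smul_eq_mul,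
      mul_left_comm c]
    rfl

theorem curveAt_scaledForm_one (x : sl ι k) (w : ι → ℕ) :
    curveAt (scaledForm x w) 1 = killingForm k (sl ι k) x := by
  ext y
  simp [curveAt, scaledForm, killingForm_sl, Matrix.trace,
    Matrix.mul_apply, Finset.mul_sum]

variable {x : sl ι k} {w : ι → ℕ}

theorem curveAt_scaledForm_zero (hx : ∀ i j, x.val i j ≠ 0 → w i < w j) :
    curveAt (scaledForm x w) 0 = 0 := by
  ext y
  simp only [curveAt, scaledForm, LinearMap.comp_apply, LinearMap.coe_mk, AddHom.coe_mk,
    leval_apply, eval_finsetSum, LinearMap.zero_apply]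
  refine Finset.sum_eq_zero fun i _ => Finset.sum_eq_zero fun j _ => ?_
  obtain hij | hij := eq_or_ne (x.val i j) 0
  · simp [hij]
  · simp [eval_monomial, Nat.sub_ne_zero_of_lt (hx i j hij)]

variable [CharZero k]

theorem scaledForm_lie_diagTraceless (hx : ∀ i j, x.val i j ≠ 0 → w i < w j) (y : sl ι k) :
    scaledForm x w ⁅diagTraceless k w, y⁆ = X * derivative (scaledForm x w y) := by
  simp only [scaledForm, LinearMap.coe_mk, AddHom.coe_mk, derivative_sum,
    Finset.mul_sum, derivative_monomial, lie_diagTraceless_apply]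
  refine Finset.sum_congr rfl fun i _ => Finset.sum_congr rfl fun j _ => ?_
  obtain hij | hij := eq_or_ne (x.val i j) 0
  · simp [hij]
  · have hw := hx i j hij
    rw [X_mul_monomial, Nat.sub_add_cancel (Nat.sub_pos_of_lt hw), Nat.cast_sub hw.le]
    congr 1
    ring

theorem killingForm_mem_nullcone (hx : ∀ i j, x.val i j ≠ 0 → w i < w j) :
    killingForm k (sl ι k) x ∈ nullcone k (sl ι k) := by
  rw [← curveAt_scaledForm_one x w]
  exact curveAt_one_mem_nullcone (scaledForm_lie_diagTraceless hx) (curveAt_scaledForm_zero hx)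

end Nullcone

section KrullDimension

variable {Y : Type*} [TopologicalSpace Y] [T1Space Y]

theorem subsingleton_of_isPreirreducible_of_finite {s : Set Y} (hs : IsPreirreducible s)
    (hfin : s.Finite) : s.Subsingleton := by
  have : Finite s := hfin
  have : PreirreducibleSpace s := Subtype.preirreducibleSpace hs
  exact Set.subsingleton_coe s |>.mp <| Set.subsingleton_univ_iff.mp <|
    (PreirreducibleSpace.isPreirreducible_univ (X := s)).subsingleton

variable {T : Type*} {g : CofiniteTopology T → Y}

theorem subsingleton_or_eq_closure_range (hg : Continuous g) (hfin : (Set.range g)ᶜ.Finite)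
    (hinf : (Set.range g).Infinite) (D : TopologicalSpace.IrreducibleCloseds Y) :
    (D : Set Y).Subsingleton ∨ (D : Set Y) = closure (Set.range g) := by
  obtain hD | hD := CofiniteTopology.isClosed_iff.mp (D.isClosed.preimage hg)
  · refine Or.inr (Set.Subset.antisymm ?_ ?_)
    · refine (isPreirreducible_iff_isClosed_union_isClosed.mp D.isIrreducible.isPreirreducible
        _ _ isClosed_closure hfin.isClosed ?_).resolve_right fun h => ?_
      · intro y _
        by_cases hy : y ∈ Set.range g
        exacts [Or.inl (subset_closure hy), Or.inr hy]
      · rw [Set.preimage_eq_univ_iff] at hD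
        exact hinf (hfin.subset (hD.trans h))
    · exact D.isClosed.closure_subset_iff.mpr (Set.preimage_eq_univ_iff.mp hD)
  · refine Or.inl (subsingleton_of_isPreirreducible_of_finite D.isIrreducible.isPreirreducible
      (((hD.image g).union hfin).subset fun y hy => ?_))
    by_cases hyg : y ∈ Set.range g
    · obtain ⟨t, rfl⟩ := hyg
      exact Or.inl ⟨t, hy, rfl⟩
    · exact Or.inr hyg

theorem topologicalKrullDim_eq_one [Infinite T] (hg : Continuous g) (hinj : Function.Injective g)
    (hfin : (Set.range g)ᶜ.Finite) : topologicalKrullDim Y = 1 := by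
  have infinite_range : (Set.range g).Infinite :=
    Set.infinite_range_of_injective (α := T) (f := g ∘ CofiniteTopology.of)
      (hinj.comp CofiniteTopology.of.injective) |>.mono (Set.range_comp_subset_range _ _)
  have infinite_closure := infinite_range.mono subset_closure
  have cases := subsingleton_or_eq_closure_range hg hfin infinite_range
  have irreducible_closure : IsIrreducible (closure (Set.range g)) := by
    rw [← Set.image_univ]
    exact ((IrreducibleSpace.isIrreducible_univ _).image g hg.continuousOn).closure
  refine le_antisymm (Order.krullDim_le_one_iff.mpr fun D => ?_)
    (Order.one_le_krullDim_iff.mpr ?_)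
  · refine (cases D).imp (fun hD D' hD' y hy => ?_) fun hD D' hD' => ?_
    · obtain ⟨y', hy'⟩ := D'.isIrreducible.nonempty
      rwa [hD hy (hD' hy')]
    · have hD'inf : (D' : Set Y).Infinite := infinite_closure.mono (hD ▸ hD')
      refine le_of_eq (SetLike.coe_injective ?_)
      rw [hD, (cases D').resolve_left fun h => hD'inf h.finite]
  · obtain ⟨y, hy⟩ := infinite_closure.nonempty
    refine ⟨⟨{y}, isIrreducible_singleton, isClosed_singleton⟩,
      ⟨_, irreducible_closure, isClosed_closure⟩, lt_of_le_of_ne ?_ fun h => ?_⟩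
    · exact Set.singleton_subset_iff.mpr hy
    · have : {y} = closure (Set.range g) :=
        congrArg TopologicalSpace.IrreducibleCloseds.carrier h
      exact infinite_closure (this ▸ Set.finite_singleton y)

end KrullDimension

section Zariski

open Polynomial

attribute [local instance] zariski

variable {k : Type*} [Field k] {a : Type*} [LieRing a] [LieAlgebra k a]

theorem isClosed_zeroLocus (F : SymmetricAlgebra k a) : IsClosed {f | evalAt k a f F = 0} :=
  isOpen_compl_iff.mp (TopologicalSpace.isOpen_generateFrom_of_mem ⟨F, rfl⟩)

theorem continuous_curveAt (φ : a →ₗ[k] k[X]) (S : Set k) :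
    Continuous fun c : CofiniteTopology S => curveAt φ (CofiniteTopology.of.symm c : S) := by
  refine continuous_generateFrom_iff.mpr ?_
  rintro _ ⟨F, rfl⟩
  rw [CofiniteTopology.isOpen_iff]
  rintro ⟨c, hc⟩
  simp only [Set.mem_preimage, Set.mem_ofPred_eq, ← eval_lift_eq_evalAt] at hc
  have lift_ne_zero : SymmetricAlgebra.lift φ F ≠ 0 := fun h => hc (by rw [h, eval_zero])
  refine ((finite_setOfPred_isRoot lift_ne_zero).preimage
    (Subtype.val_injective.comp CofiniteTopology.of.symm.injective).injOn).subset fun d hd => ?_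
  simpa [← eval_lift_eq_evalAt] using hd

theorem isIrred_image_curveAt (φ : a →ₗ[k] k[X]) {S : Set k} (hS : S.Infinite) :
    IsIrred k a (curveAt φ '' S) := by
  have : Infinite S := hS.to_subtype
  have range_eq : curveAt φ '' S =
      (fun c : CofiniteTopology S => curveAt φ (CofiniteTopology.of.symm c : S)) '' Set.univ := by
    rw [Set.image_univ, Set.image_eq_range]
    exact (CofiniteTopology.of.symm.surjective.range_comp fun c : S => curveAt φ c).symm
  rw [range_eq]
  exact (IrreducibleSpace.isIrreducible_univ _).image _ (continuous_curveAt φ S).continuousOn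

variable (k) in
/-- The coordinate functions of the line `c ↦ f + c g` in `a*`. -/
def lineCurve (f g : Module.Dual k a) : a →ₗ[k] k[X] :=
  Algebra.linearMap k k[X] ∘ₗ f + LinearMap.toSpanSingleton k k[X] X ∘ₗ g

theorem curveAt_lineCurve (f g : Module.Dual k a) (c : k) :
    curveAt (lineCurve k f g) c = f + c • g := by
  ext y; simp [curveAt, lineCurve, mul_comm]

theorem isClosed_line (f g : Module.Dual k a) : IsClosed (Set.range fun c : k => f + c • g) := by
  have eq_iInter : (Set.range fun c : k => f + c • g) = ⋂ x ∈ LinearMap.ker g,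
      {f' | evalAt k a f' (SymmetricAlgebra.ι k a x - algebraMap k _ (f x)) = 0} := by
    ext f'
    have mem_range : f' ∈ (Set.range fun c : k => f + c • g) ↔
        f' - f ∈ Submodule.span k {g} := by
      simp [Submodule.mem_span_singleton, eq_sub_iff_add_eq, add_comm]
    rw [mem_range]
    simp only [Set.mem_iInter, Set.mem_ofPred_eq, map_sub, evalAt,
      SymmetricAlgebra.lift_ι_apply, AlgHom.commutes, Algebra.algebraMap_self, RingHom.id_apply]
    refine ⟨fun h x hx => ?_, fun h => ?_⟩
    · obtain ⟨c, hc⟩ := Submodule.mem_span_singleton.mp h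
      simpa [LinearMap.mem_ker.mp hx] using (LinearMap.congr_fun hc x).symm
    · rw [← Set.range_const (ι := Unit)]
      refine mem_span_of_iInf_ker_le_ker fun x hx => ?_
      exact h x (by simpa using hx)
  rw [eq_iInter]
  exact isClosed_biInter fun x _ => isClosed_zeroLocus _

theorem t1Space_zariski : T1Space (Module.Dual k a) :=
  ⟨fun f => by simpa using isClosed_line f 0⟩

theorem IsSubvariety.union_singleton {X Z : Set (Module.Dual k a)} (hZ : IsSubvariety k a X Z)
    {f : Module.Dual k a} (hf : f ∈ X) : IsSubvariety k a X (Z ∪ {f}) := by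
  obtain ⟨T, T_closed, rfl⟩ := hZ
  have : T1Space (Module.Dual k a) := t1Space_zariski
  refine ⟨T ∪ {f}, T_closed.union isClosed_singleton, ?_⟩
  rw [Set.union_inter_distrib_right, Set.inter_eq_left.mpr (Set.singleton_subset_iff.mpr hf)]

theorem dimension_curveAt_union {φ : a →ₗ[k] k[X]} (hφ : Function.Injective (curveAt φ))
    {S : Set k} (hS : S.Infinite) {E : Set (Module.Dual k a)} (hE : E.Finite) :
    dimension k a (curveAt φ '' S ∪ E) = 1 := by
  have : Infinite S := hS.to_subtype
  have : T1Space (Module.Dual k a) := t1Space_zariski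
  let g (c : CofiniteTopology S) : (curveAt φ '' S ∪ E : Set (Module.Dual k a)) :=
    ⟨curveAt φ (CofiniteTopology.of.symm c : S), Or.inl ⟨_, (CofiniteTopology.of.symm c).2, rfl⟩⟩
  refine topologicalKrullDim_eq_one (g := g)
    ((continuous_curveAt φ S).subtype_mk _) (fun c d h => ?_) ?_
  · exact CofiniteTopology.of.symm.injective (Subtype.ext (hφ (congrArg Subtype.val h)))
  · refine (hE.preimage Subtype.val_injective.injOn).subset ?_
    rintro ⟨f, ⟨c, hc, rfl⟩ | hf⟩ hfg
    · exact absurd ⟨CofiniteTopology.of ⟨c, hc⟩, rfl⟩ hfg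
    · exact hf

variable {f g : Module.Dual k a} {S : Set k}

theorem isIrred_line (hS : S.Infinite) : IsIrred k a ((fun c : k => f + c • g) '' S) := by
  simpa only [curveAt_lineCurve] using isIrred_image_curveAt (lineCurve k f g) hS

theorem dimension_line_union (hg : g ≠ 0) (hS : S.Infinite) {E : Set (Module.Dual k a)}
    (hE : E.Finite) : dimension k a ((fun c : k => f + c • g) '' S ∪ E) = 1 := by
  have := dimension_curveAt_union (φ := lineCurve k f g) (fun c d h => ?_) hS hE
  · simpa only [curveAt_lineCurve] using this
  · simp only [curveAt_lineCurve] at h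
    exact smul_left_injective k hg (add_left_cancel h)

end Zariski

section CommutantDim

open Polynomial

variable {k : Type*} [Field k]

theorem isTorsion_AEval' {V : Type*} [AddCommGroup V] [Module k V] [FiniteDimensional k V]
    (f : Module.End k V) : Module.IsTorsion k[X] (Module.AEval' f) := by
  intro m
  refine ⟨⟨minpoly k f, mem_nonZeroDivisors_of_ne_zero
    (minpoly.ne_zero (Algebra.IsIntegral.isIntegral f))⟩, ?_⟩
  obtain ⟨v, rfl⟩ := (Module.AEval'.of f).surjective m
  change minpoly k f • Module.AEval.of k V f v = 0
  rw [← Module.AEval.of_aeval_smul, minpoly.aeval, zero_smul, map_zero]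

variable (k) in
/-- The dimension of the commutant of an element of an algebra. -/
def commutantDim {𝒜 : Type*} [Ring 𝒜] [Algebra k 𝒜] (a : 𝒜) : ℕ :=
  Module.finrank k (Subalgebra.centralizer k {a})

theorem mem_centralizer_singleton {𝒜 : Type*} [Ring 𝒜] [Algebra k 𝒜] {a u : 𝒜} :
    u ∈ Subalgebra.centralizer k {a} ↔ Commute a u := by
  simp [Subalgebra.mem_centralizer_iff, commute_iff_eq]

theorem commutantDim_algEquiv {𝒜 ℬ : Type*} [Ring 𝒜] [Algebra k 𝒜] [Ring ℬ] [Algebra k ℬ]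
    (φ : 𝒜 ≃ₐ[k] ℬ) (a : 𝒜) : commutantDim k (φ a) = commutantDim k a := by
  have map_centralizer : (Subalgebra.centralizer k {a}).map (φ : 𝒜 →ₐ[k] ℬ) =
      Subalgebra.centralizer k {φ a} := by
    ext u
    obtain ⟨v, rfl⟩ := φ.surjective u
    rw [mem_centralizer_singleton, commute_map_iff φ.injective,
      ← mem_centralizer_singleton (k := k)]
    exact φ.injective.mem_set_image (s := (Subalgebra.centralizer k {a} : Set 𝒜))
  rw [commutantDim, ← map_centralizer]
  exact ((Subalgebra.centralizer k {a}).equivMapOfInjective (φ : 𝒜 →ₐ[k] ℬ)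
    φ.injective).symm.toLinearEquiv.finrank_eq

section End

variable {V : Type*} [AddCommGroup V] [Module k V] (f : Module.End k V)

/-- Multiplications in `B` commute with the multiplication by `X` on `V ≅ B`. -/
theorem finrank_le_commutantDim_of_linearEquiv {B : Type*} [CommRing B] [Algebra k[X] B]
    [FiniteDimensional k V] (e : Module.AEval' f ≃ₗ[k[X]] B) :
    Module.finrank k V ≤ commutantDim k f := by
  algebraize [(algebraMap k[X] B).comp (algebraMap k k[X])]
  let E : V ≃ₗ[k] B := Module.AEval'.of f ≪≫ₗ e.restrictScalars k
  have E_apply (v : V) : E (f v) = algebraMap k[X] B X * E v := by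
    change e (Module.AEval'.of f (f v)) = algebraMap k[X] B X * e (Module.AEval'.of f v)
    rw [← Module.AEval'.X_smul_of, map_smul, Algebra.smul_def]
  let M : B →ₗ[k] Module.End k V := E.symm.conj.toLinearMap ∘ₗ LinearMap.mul k B
  have commute (b : B) : M b ∈ Subalgebra.centralizer k {f} := by
    refine mem_centralizer_singleton.mpr (LinearMap.ext fun v => E.injective ?_)
    simp [M, LinearEquiv.conj_apply, E_apply, mul_left_comm]
  have injective : Function.Injective M :=
    E.symm.conj.injective.comp fun b c h => by simpa using LinearMap.congr_fun h 1
  rw [E.finrank_eq]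
  exact LinearMap.finrank_le_finrank_of_injective
    (f := M.codRestrict (Subalgebra.toSubmodule (Subalgebra.centralizer k {f})) commute)
    fun b c h => injective (congrArg Subtype.val h)

theorem finrank_le_commutantDim [FiniteDimensional k V] :
    Module.finrank k V ≤ commutantDim k f := by
  obtain ⟨ι, _, q, -, m, ⟨e⟩⟩ := Module.equiv_directSum_of_isTorsion (isTorsion_AEval' f)
  classical
  exact finrank_le_commutantDim_of_linearEquiv f (B := ∀ i, k[X] ⧸ Ideal.span {q i ^ m i})
    (e ≪≫ₗ DirectSum.linearEquivFunOnFintype _ _ _)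

end End

variable {ι : Type*} [Fintype ι] [DecidableEq ι]

theorem card_le_commutantDim (A : Matrix ι ι k) : Fintype.card ι ≤ commutantDim k A := by
  rw [← commutantDim_algEquiv Matrix.toLinAlgEquiv' A, ← Module.finrank_fintype_fun_eq_card k]
  exact finrank_le_commutantDim _

/-- Counting the linear conditions for a matrix supported on `D` to commute with `A`. -/
theorem card_le_commutantDim_add_card {A : Matrix ι ι k} {D S : Finset (ι × ι)}
    (hDS : ∀ u : Matrix ι ι k, (∀ i j, u i j ≠ 0 → (i, j) ∈ D) →
      ∀ i j, (A * u - u * A) i j ≠ 0 → (i, j) ∈ S) :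
    D.card ≤ commutantDim k A + S.card := by
  let M : (D → k) →ₗ[k] Matrix ι ι k :=
    { toFun c := Matrix.of fun i j => if h : (i, j) ∈ D then c ⟨(i, j), h⟩ else 0
      map_add' c d := by ext i j; by_cases h : (i, j) ∈ D <;> simp [h]
      map_smul' r c := by ext i j; by_cases h : (i, j) ∈ D <;> simp [h] }
  have M_injective : Function.Injective M := fun c d h => by
    ext ⟨⟨i, j⟩, hq⟩
    simpa [M, hq] using congrFun (congrFun h i) j
  let Φ : (D → k) →ₗ[k] (S → k) :=
    LinearMap.pi fun q => Matrix.entryLinearMap k k q.1.1 q.1.2 ∘ₗ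
      (LinearMap.mulLeft k A - LinearMap.mulRight k A) ∘ₗ M
  have commute (c : LinearMap.ker Φ) : M c ∈ Subalgebra.centralizer k {A} := by
    rw [mem_centralizer_singleton, commute_iff_eq, ← sub_eq_zero]
    ext i j
    by_contra h
    have hS := hDS (M c) (fun i j hij => by contrapose! hij; simp [M, hij]) i j h
    exact h (congrFun (LinearMap.mem_ker.mp c.2) ⟨(i, j), hS⟩)
  have ker_le : Module.finrank k (LinearMap.ker Φ) ≤ commutantDim k A :=
    LinearMap.finrank_le_finrank_of_injective
      (f := (M ∘ₗ (LinearMap.ker Φ).subtype).codRestrict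
        (Subalgebra.toSubmodule (Subalgebra.centralizer k {A})) commute)
      fun u v h => Subtype.ext (M_injective (congrArg Subtype.val h))
  have range_le : Module.finrank k (LinearMap.range Φ) ≤ S.card := by
    simpa using Submodule.finrank_le (LinearMap.range Φ)
  calc D.card = Module.finrank k (LinearMap.range Φ) + Module.finrank k (LinearMap.ker Φ) := by
        simp [Φ.finrank_range_add_finrank_ker]
    _ ≤ commutantDim k A + S.card := by omega

end CommutantDim

section StrictlyTriangular

variable {k : Type*} [Field k] {n : ℕ} {A : Matrix (Fin n) (Fin n) k}

theorem pow_apply_eq_zero (hA : ∀ i j, A i j ≠ 0 → i < j) (m : ℕ) {i j : Fin n}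
    (hij : (j : ℕ) < i + m) : (A ^ m) i j = 0 := by
  induction m generalizing i with
  | zero => exact Matrix.one_apply_ne (by omega)
  | succ m ih =>
    rw [pow_succ', Matrix.mul_apply]
    refine Finset.sum_eq_zero fun l _ => ?_
    by_contra! h
    have hil := hA i l (left_ne_zero_of_mul h)
    exact right_ne_zero_of_mul h (ih (by omega))

theorem pow_apply_ne_zero (hA : ∀ i j, A i j ≠ 0 → i < j)
    (hsup : ∀ i j : Fin n, (i : ℕ) + 1 = j → A i j ≠ 0) (m : ℕ) {i j : Fin n}
    (hij : (i : ℕ) + m = j) : (A ^ m) i j ≠ 0 := by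
  induction m generalizing i with
  | zero => simp [Fin.ext hij]
  | succ m ih =>
    rw [pow_succ', Matrix.mul_apply, Finset.sum_eq_single ⟨i + 1, by omega⟩]
    · exact mul_ne_zero (hsup _ _ rfl) (ih (by simp only; omega))
    · intro l _ hl
      by_contra! h
      have hil := hA i l (left_ne_zero_of_mul h)
      have hle : ¬ (j : ℕ) < l + m := fun hlt => right_ne_zero_of_mul h (pow_apply_eq_zero hA m hlt)
      exact hl (Fin.ext (by simp only; omega))
    · simp

/-- The first row vector is cyclic for `A`, so that a matrix commuting with `A` is determined by its
first row. -/
theorem commutantDim_le_of_superdiagonal (hA : ∀ i j, A i j ≠ 0 → i < j)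
    (hsup : ∀ i j : Fin n, (i : ℕ) + 1 = j → A i j ≠ 0) : commutantDim k A ≤ n := by
  obtain rfl | hn := eq_or_ne n 0
  · exact (Module.finrank_zero_of_subsingleton (R := k)).le
  have : NeZero n := ⟨hn⟩
  let P : Matrix (Fin n) (Fin n) k := Matrix.of fun m => (A ^ (m : ℕ)) 0
  have P_det : P.det ≠ 0 := by
    have triangular : P.IsUpperTriangular := fun i j hij =>
      pow_apply_eq_zero hA i (by simpa using hij)
    rw [Matrix.det_of_isUpperTriangular triangular]
    exact Finset.prod_ne_zero_iff.mpr fun i _ => pow_apply_ne_zero hA hsup i (by simp)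
  let firstRow : Subalgebra.centralizer k {A} →ₗ[k] (Fin n → k) :=
    LinearMap.proj 0 ∘ₗ (Matrix.ofLinearEquiv k).symm.toLinearMap ∘ₗ
      (Subalgebra.toSubmodule (Subalgebra.centralizer k {A})).subtype
  have firstRow_injective : Function.Injective firstRow := by
    rw [injective_iff_map_eq_zero]
    intro u hu
    have P_mul : P * u.val = 0 := by
      ext m j
      have commute := (mem_centralizer_singleton.mp u.2).pow_left m
      calc (A ^ (m : ℕ) * u.val) 0 j = (u.val * A ^ (m : ℕ)) 0 j := by rw [commute.eq]
        _ = 0 := by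
          rw [Matrix.mul_apply]
          exact Finset.sum_eq_zero fun l _ => by
            rw [show u.val 0 l = 0 from congrFun hu l, zero_mul]
    have P_isUnit : IsUnit P := (Matrix.isUnit_iff_isUnit_det P).mpr P_det.isUnit
    exact Subtype.ext (P_isUnit.mul_right_eq_zero.mp P_mul)
  exact (LinearMap.finrank_le_finrank_of_injective firstRow_injective).trans (by simp)

theorem card_filter_le_eq_card_filter_lt_add (ι : Type*) [Fintype ι] [LinearOrder ι] :
    (Finset.univ.filter fun q : ι × ι => q.1 ≤ q.2).card =
      (Finset.univ.filter fun q : ι × ι => q.1 < q.2).card + Fintype.card ι := by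
  have diag_card : (Finset.univ.filter fun q : ι × ι => q.1 = q.2).card = Fintype.card ι := by
    rw [show (Finset.univ.filter fun q : ι × ι => q.1 = q.2) = Finset.univ.diag by ext; simp,
      Finset.diag_card, Finset.card_univ]
  rw [← diag_card, ← Finset.card_union_of_disjoint, ← Finset.filter_or]
  · simp only [le_iff_lt_or_eq]
  · exact Finset.disjoint_filter.mpr fun q _ h => h.ne

/-- A zero entry just above the diagonal saves one of the linear conditions for an upper triangular
matrix to commute with `A`. -/
theorem lt_commutantDim_of_superdiagonal_eq_zero (hA : ∀ i j, A i j ≠ 0 → i < j) {s t : Fin n}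
    (hst : (s : ℕ) + 1 = t) (h0 : A s t = 0) : n < commutantDim k A := by
  have s_lt_t : s < t := by omega
  have count : (Finset.univ.filter fun q : Fin n × Fin n => q.1 ≤ q.2).card ≤ commutantDim k A +
      ((Finset.univ.filter fun q : Fin n × Fin n => q.1 < q.2).erase (s, t)).card := by
    refine card_le_commutantDim_add_card fun u hu i j hij => ?_
    simp only [Finset.mem_filter_univ] at hu
    have supported : (∃ l, A i l ≠ 0 ∧ u l j ≠ 0) ∨ ∃ l, u i l ≠ 0 ∧ A l j ≠ 0 := by
      contrapose! hij
      rw [Matrix.sub_apply, Matrix.mul_apply, Matrix.mul_apply, Finset.sum_eq_zero,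
        Finset.sum_eq_zero, sub_zero]
      · exact fun l _ => by by_cases h : u i l = 0 <;> simp [h, hij.2 l]
      · exact fun l _ => by by_cases h : A i l = 0 <;> simp [h, hij.1 l]
    simp only [Finset.mem_erase, Finset.mem_filter_univ, ne_eq, Prod.mk.injEq]
    obtain ⟨l, hil, hlj⟩ | ⟨l, hil, hlj⟩ := supported
    · have := hA i l hil
      have := hu l j hlj
      refine ⟨?_, by omega⟩
      rintro ⟨rfl, rfl⟩
      exact hil (by rwa [show l = j by omega])
    · have := hu i l hil
      have := hA l j hlj
      refine ⟨?_, by omega⟩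
      rintro ⟨rfl, rfl⟩
      exact hlj (by rwa [show l = i by omega])
  rw [card_filter_le_eq_card_filter_lt_add, Fintype.card_fin,
    Finset.card_erase_of_mem (by simpa using s_lt_t)] at count
  have : 0 < (Finset.univ.filter fun q : Fin n × Fin n => q.1 < q.2).card :=
    Finset.card_pos.mpr ⟨(s, t), by simpa using s_lt_t⟩
  omega

end StrictlyTriangular

section Regular

variable {k : Type*} [Field k] {n : ℕ}

/-- The matrix `A` is strictly triangular for the total order of its indices listed by `e`. -/
def IsTriangularFor (e : Equiv.Perm (Fin n)) (A : Matrix (Fin n) (Fin n) k) : Prop :=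
  ∀ i j, A i j ≠ 0 → e.symm i < e.symm j

theorem IsTriangularFor.commutantDim_eq_iff {e : Equiv.Perm (Fin n)}
    {A : Matrix (Fin n) (Fin n) k} (hA : IsTriangularFor e A) :
    commutantDim k A = n ↔ ∀ s t : Fin n, (s : ℕ) + 1 = t → A (e s) (e t) ≠ 0 := by
  rw [← commutantDim_algEquiv (Matrix.reindexAlgEquiv k k e.symm) A, Matrix.coe_reindexAlgEquiv,
    Matrix.reindex_apply]
  set B := A.submatrix e.symm.symm e.symm.symm
  have B_upper : ∀ i j, B i j ≠ 0 → i < j := fun i j hij => by simpa using hA _ _ hij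
  constructor
  · intro hdim s t hst h0
    exact (lt_commutantDim_of_superdiagonal_eq_zero B_upper hst h0).ne' hdim
  · intro hsup
    refine le_antisymm (commutantDim_le_of_superdiagonal B_upper hsup) ?_
    simpa using card_le_commutantDim B

variable [CharZero k]

theorem finrank_stabilizer_add_one {ι : Type*} [Fintype ι] [DecidableEq ι] [Nonempty ι]
    (x : sl ι k) :
    Module.finrank k (stabilizer k (sl ι k) (killingForm k (sl ι k) x)) + 1 =
      commutantDim k x.val := by
  let commutant := Subalgebra.toSubmodule (Subalgebra.centralizer k {x.val})
  let tr : commutant →ₗ[k] k := Matrix.traceLinearMap ι k k ∘ₗ commutant.subtype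
  have tr_ne_zero : tr ≠ 0 := fun h => by
    have : tr ⟨1, one_mem (Subalgebra.centralizer k {x.val})⟩ = 0 := by rw [h, LinearMap.zero_apply]
    simp [tr] at this
  let stabilizerEquiv : stabilizer k (sl ι k) (killingForm k (sl ι k) x) ≃ₗ[k] LinearMap.ker tr :=
    { toFun := fun u =>
        ⟨⟨u.1.1, (mem_centralizer_singleton (k := k)).mpr (mem_stabilizer_killingForm.mp u.2)⟩,
          u.1.2⟩
      invFun := fun u => ⟨⟨u.1.1, u.2⟩,
        mem_stabilizer_killingForm.mpr ((mem_centralizer_singleton (k := k)).mp u.1.2)⟩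
      map_add' := fun _ _ => rfl
      map_smul' := fun _ _ => rfl }
  have rank_nullity := tr.finrank_range_add_finrank_ker
  rw [LinearMap.range_eq_top.mpr (LinearMap.surjective tr_ne_zero), finrank_top,
    Module.finrank_self, add_comm, ← stabilizerEquiv.finrank_eq] at rank_nullity
  exact rank_nullity

theorem exists_commutantDim_eq (k : Type*) [Field k] (n : ℕ) :
    ∃ x : sl (Fin n) k, commutantDim k x.val = n := by
  let J : Matrix (Fin n) (Fin n) k := Matrix.of fun i j => if (i : ℕ) + 1 = j then 1 else 0
  have J_trace : J.trace = 0 := Finset.sum_eq_zero fun i _ => by simp [J]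
  refine ⟨⟨J, J_trace⟩, le_antisymm (commutantDim_le_of_superdiagonal ?_ ?_) ?_⟩
  · intro i j hij
    have : (i : ℕ) + 1 = j := by simpa [J] using hij
    omega
  · exact fun i j hij => by simp [J, hij]
  · simpa using card_le_commutantDim J

theorem killingForm_mem_regularSet_iff {x : sl (Fin n) k} :
    killingForm k (sl (Fin n) k) x ∈ regularSet k (sl (Fin n) k) ↔ commutantDim k x.val = n := by
  obtain rfl | hn := eq_or_ne n 0
  · have : Subsingleton (sl (Fin 0) k) := ⟨fun x y => Subtype.ext (Subsingleton.elim _ _)⟩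
    refine iff_of_true (fun g => ?_) Module.finrank_zero_of_subsingleton
    rw [Module.finrank_zero_of_subsingleton]
    exact Nat.zero_le _
  have : NeZero n := ⟨hn⟩
  constructor
  · intro hx
    obtain ⟨y, hy⟩ := exists_commutantDim_eq k n
    have hxy := hx (killingForm k (sl (Fin n) k) y)
    have le_x := card_le_commutantDim x.val
    rw [Fintype.card_fin] at le_x
    rw [← finrank_stabilizer_add_one] at *
    omega
  · intro hx g
    obtain ⟨y, rfl⟩ := killingForm_sl_surjective g
    have le_y := card_le_commutantDim y.val
    rw [Fintype.card_fin] at le_y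
    rw [← finrank_stabilizer_add_one] at *
    omega

/-- A nilpotent matrix, triangularized, is regular if and only if no entry just above the diagonal
vanishes. -/
theorem IsTriangularFor.mem_regNullcone_iff {e : Equiv.Perm (Fin n)} {x : sl (Fin n) k}
    (hx : IsTriangularFor e x.val) :
    killingForm k (sl (Fin n) k) x ∈ regNullcone k (sl (Fin n) k) ↔
      ∀ s t : Fin n, (s : ℕ) + 1 = t → x.val (e s) (e t) ≠ 0 := by
  rw [← hx.commutantDim_eq_iff, ← killingForm_mem_regularSet_iff]
  exact and_iff_right (killingForm_mem_nullcone (w := fun i => e.symm i) hx)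

end Regular

section Meander

variable {n p : ℕ}

theorem isComponent_simpleRoots_sdiff_iff (hpn : p ≤ n) {r s : Fin n} :
    IsComponent (simpleRoots n \ {p}) r s ↔
      (r : ℕ) = 0 ∧ (s : ℕ) + 1 = p ∨ (r : ℕ) = p ∧ (s : ℕ) + 1 = n := by
  simp only [IsComponent, SupportedIn, simpleRoots, Set.mem_sdiff, Set.mem_Ico,
    Set.mem_singleton_iff, Fin.le_def]
  constructor
  · rintro ⟨hrs, supported, hr, hs⟩
    have := supported p
    omega
  · intro h
    refine ⟨by omega, fun l hrl hls => by omega, by omega, by omega⟩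

theorem mem_cascade_simpleRoots_sdiff_iff (hpn : p ≤ n) {γ : Fin n × Fin n} :
    γ ∈ cascade (simpleRoots n \ {p}) ↔ γ.1 < γ.2 ∧
      ((γ.1 : ℕ) + γ.2 + 1 = p ∨ p ≤ (γ.1 : ℕ) ∧ (γ.1 : ℕ) + γ.2 + 1 = n + p) := by
  simp only [cascade, Set.mem_ofPred_eq, isComponent_simpleRoots_sdiff_iff hpn, Fin.le_def]
  refine and_congr_right fun hγ => ⟨?_, ?_⟩
  · rintro ⟨r, s, component, hr, _, hsum⟩
    omega
  · rintro (hsum | ⟨_, hsum⟩)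
    · exact ⟨⟨0, by omega⟩, ⟨p - 1, by omega⟩, by simp only [true_and]; omega⟩
    · exact ⟨⟨p, by omega⟩, ⟨n - 1, by omega⟩, by simp only [true_and]; omega⟩

theorem mem_cascade_simpleRoots_iff {γ : Fin n × Fin n} :
    γ ∈ cascade (simpleRoots n) ↔ γ.1 < γ.2 ∧ (γ.1 : ℕ) + γ.2 + 1 = n := by
  have : simpleRoots n = simpleRoots n \ {0} := by simp [simpleRoots]
  rw [this, mem_cascade_simpleRoots_sdiff_iff (Nat.zero_le n)]
  omega

/-- The edges of the meander graph of the parabolic with blocks of sizes `p` and `n - p`, with the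
orientation given by the roots of `𝒦 ∪ (-𝒦')`. -/
def MeanderEdge (n p : ℕ) (i j : Fin n) : Prop :=
  (i < j ∧ (i : ℕ) + j + 1 = n) ∨ (j < i ∧ (i : ℕ) + j + 1 = p) ∨
    (j < i ∧ p ≤ j ∧ (i : ℕ) + j + 1 = n + p)

theorem mem_cascadeRoots_iff (hpn : p ≤ n) {γ : Fin n × Fin n} :
    γ ∈ cascadeRoots (simpleRoots n) (simpleRoots n \ {p}) ↔ MeanderEdge n p γ.1 γ.2 := by
  rw [cascadeRoots, Set.mem_union, Set.mem_ofPred_eq, mem_cascade_simpleRoots_iff,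
    mem_cascade_simpleRoots_sdiff_iff hpn, MeanderEdge, add_comm (γ.2 : ℕ), and_or_left]

theorem isExceptional_iff (hpn : p ≤ n) {γ : Fin n × Fin n} :
    IsExceptional (simpleRoots n) (simpleRoots n \ {p}) γ ↔
      MeanderEdge n p γ.1 γ.2 ∧ IsSimpleUpToSign γ :=
  and_congr_left' (mem_cascadeRoots_iff hpn)

theorem MeanderEdge.ne {i j : Fin n} (h : MeanderEdge n p i j) : i ≠ j := by
  rintro rfl
  simp only [MeanderEdge] at h
  omega

theorem MeanderEdge.asymm (hp : 1 ≤ p) (hpn : p < n) {i j : Fin n} (h : MeanderEdge n p i j) :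
    ¬ MeanderEdge n p j i := by
  simp only [MeanderEdge] at h ⊢
  omega

theorem odd_or_odd_of_coprime (hcop : Nat.Coprime p n) : p % 2 = 1 ∨ n % 2 = 1 := by
  by_contra! h
  exact Nat.not_coprime_of_dvd_of_dvd one_lt_two (Nat.dvd_of_mod_eq_zero (by omega))
    (Nat.dvd_of_mod_eq_zero (by omega)) hcop

/-- A simple edge joins the two central vertices of a block of even size, and exactly one of the
numbers `n`, `p` and `n - p` is even. -/
theorem existsUnique_simple_meanderEdge (hp : 1 ≤ p) (hpn : p < n) (hcop : Nat.Coprime p n) :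
    ∃! γ : Fin n × Fin n, MeanderEdge n p γ.1 γ.2 ∧ IsSimpleUpToSign γ := by
  have parity := odd_or_odd_of_coprime hcop
  simp only [MeanderEdge, IsSimpleUpToSign]
  refine existsUnique_of_exists_of_unique ?_ fun γ δ hγ hδ => ?_
  · obtain ⟨m, rfl | rfl⟩ := Nat.even_or_odd' n
    · exact ⟨(⟨m - 1, by omega⟩, ⟨m, by omega⟩), by simp only [Fin.mk_lt_mk]; omega⟩
    obtain ⟨q, rfl | rfl⟩ := Nat.even_or_odd' p
    · exact ⟨(⟨q, by omega⟩, ⟨q - 1, by omega⟩), by simp only [Fin.mk_lt_mk]; omega⟩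
    · exact ⟨(⟨m + q + 1, by omega⟩, ⟨m + q, by omega⟩), by
        simp only [Fin.mk_lt_mk, or_true, and_true]
        omega⟩
  · ext <;> omega

theorem meanderEdge_sub_iff_rev (hpn : p ≤ n) {i j : Fin n} :
    MeanderEdge n (n - p) i j ↔ MeanderEdge n p j.rev i.rev := by
  simp only [MeanderEdge, Fin.lt_def, Fin.val_rev]
  omega

theorem isSimpleUpToSign_iff_rev {i j : Fin n} :
    IsSimpleUpToSign (i, j) ↔ IsSimpleUpToSign (j.rev, i.rev) := by
  simp only [IsSimpleUpToSign, Fin.val_rev]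
  omega

/-- The place of a vertex in the enumeration `0, n - 1, 1, n - 2, …`. -/
def zigzag (v : Fin n) : Fin n :=
  ⟨if 2 * (v : ℕ) < n then 2 * v else 2 * (n - 1 - v) + 1, by split_ifs <;> omega⟩

theorem val_zigzag (v : Fin n) :
    (zigzag v : ℕ) = if 2 * (v : ℕ) < n then 2 * (v : ℕ) else 2 * (n - 1 - v) + 1 :=
  rfl

theorem zigzag_injective : Function.Injective (zigzag (n := n)) := by
  intro v w hvw
  have := congrArg Fin.val hvw
  rw [val_zigzag, val_zigzag] at this
  split_ifs at this <;> omega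

/-- The graph for `p = 1` is an oriented path. -/
theorem meanderEdge_one_iff {i j : Fin n} :
    MeanderEdge n 1 i j ↔ (zigzag i : ℕ) + 1 = zigzag j := by
  rw [val_zigzag, val_zigzag]
  simp only [MeanderEdge]
  split_ifs <;> omega

theorem exists_two_mul_add_one_eq (hcop : Nat.Coprime p n) : ∃ v : ZMod n, 2 * v + 1 = p := by
  have parity := odd_or_odd_of_coprime hcop
  obtain ⟨m, hm⟩ : ∃ m, 2 * m + 1 = p ∨ 2 * m + 1 = p + n :=
    ⟨if p % 2 = 1 then p / 2 else (p + n) / 2, by split_ifs <;> omega⟩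
  refine ⟨m, ?_⟩
  obtain hm | hm := hm <;> simpa using congrArg (Nat.cast : ℕ → ZMod n) hm

/-- The two involutions `v ↦ -1 - v` and `v ↦ p - 1 - v` of `ZMod n`, whose orbits contain the edges
of the graph, are turned into `u ↦ -1 - u` and `u ↦ -u` by the change of variables `v = v₀ + p u`,
where `2 v₀ + 1 = p`. -/
theorem exists_injective_meanderEdge_one (hn : n ≠ 0) (hcop : Nat.Coprime p n) :
    ∃ σ : Fin n → Fin n, Function.Injective σ ∧ ∀ i j, MeanderEdge n p i j →
      MeanderEdge n 1 (σ i) (σ j) ∨ MeanderEdge n 1 (σ j) (σ i) := by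
  have : NeZero n := ⟨hn⟩
  obtain ⟨v₀, hv₀⟩ := exists_two_mul_add_one_eq hcop
  obtain ⟨q, hq⟩ := (ZMod.isUnit_iff_coprime p n).mpr hcop
  let u : Fin n → ZMod n := fun v => q⁻¹ * ((v : ℕ) - v₀)
  have mul_u (v : Fin n) : (p : ZMod n) * u v = (v : ℕ) - v₀ := by
    rw [← hq, Units.mul_inv_cancel_left]
  have u_injective : Function.Injective u := fun v w hvw => by
    have := sub_left_injective (q⁻¹.isUnit.mul_right_injective hvw)
    simpa [ZMod.natCast_eq_natCast_iff', Nat.mod_eq_of_lt, Fin.ext_iff] using this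
  have eq_n {s : ℕ} (hs : (p : ZMod n) * s = 0) (h0 : s ≠ 0) (hlt : s < 2 * n) : s = n := by
    rw [← hq, Units.mul_right_eq_zero, ZMod.natCast_eq_zero_iff] at hs
    exact Nat.eq_of_dvd_of_lt_two_mul h0 hs hlt
  refine ⟨fun v => ⟨(u v).val, ZMod.val_lt _⟩, fun v w hvw =>
    u_injective (ZMod.val_injective n (Fin.mk.inj hvw)), fun i j hij => ?_⟩
  have u_ne : (u i).val ≠ (u j).val := fun h => hij.ne (u_injective (ZMod.val_injective n h))
  have := ZMod.val_lt (u i)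
  have := ZMod.val_lt (u j)
  have sum_eq : (u i).val + (u j).val + 1 = n ∨ (u i).val + (u j).val = n := by
    have mul_add_u : (p : ZMod n) * (u i + u j) = ((i + j + 1 : ℕ) : ZMod n) - p := by
      rw [mul_add, mul_u, mul_u, ← hv₀]
      push_cast
      ring
    obtain ⟨-, hsum⟩ | ⟨-, hsum⟩ | ⟨-, -, hsum⟩ := hij
    · refine Or.inl (eq_n ?_ (by omega) (by omega))
      push_cast
      rw [ZMod.natCast_zmod_val, ZMod.natCast_zmod_val, mul_add, mul_add_u, hsum]
      simp
    all_goals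
      refine Or.inr (eq_n ?_ (by omega) (by omega))
      push_cast
      rw [ZMod.natCast_zmod_val, ZMod.natCast_zmod_val, mul_add_u, hsum]
      simp
  simp only [MeanderEdge, Fin.mk_lt_mk]
  omega

/-- On an oriented graph contained in a path, there is a potential with prescribed increments along
the edges. -/
theorem exists_potential {V M : Type*} [AddCommGroup M] {pos : V → ℕ}
    (hpos : Function.Injective pos) {E : V → V → Prop}
    (hE : ∀ i j, E i j → pos j = pos i + 1 ∨ pos i = pos j + 1)
    (hasymm : ∀ i j, E i j → ¬ E j i) (weight : V → V → M) :
    ∃ H : V → M, ∀ i j, E i j → H j = H i + weight i j := by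
  classical
  obtain hV | hV := isEmpty_or_nonempty V
  · exact ⟨fun _ => 0, fun i => isEmptyElim i⟩
  let vertex := Function.invFun pos
  have vertex_pos : ∀ v, vertex (pos v) = v := Function.leftInverse_invFun hpos
  let increment : ℕ → M := fun s =>
    if E (vertex s) (vertex (s + 1)) then weight (vertex s) (vertex (s + 1))
    else - weight (vertex (s + 1)) (vertex s)
  refine ⟨fun v => ∑ s ∈ Finset.range (pos v), increment s, fun i j hij => ?_⟩
  obtain hsucc | hsucc := hE i j hij
  · have hj : vertex (pos i + 1) = j := by rw [← hsucc, vertex_pos]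
    simp only [hsucc, Finset.sum_range_succ, increment, hj, vertex_pos, hij, if_true]
  · have hi : vertex (pos j + 1) = i := by rw [← hsucc, vertex_pos]
    simp only [hsucc, Finset.sum_range_succ, increment, hi, vertex_pos, hasymm i j hij, if_false,
      neg_add_cancel_right]

theorem exists_meander_potential (hp : 1 ≤ p) (hpn : p < n) (hcop : Nat.Coprime p n)
    {M : Type*} [AddCommGroup M] (weight : Fin n → Fin n → M) :
    ∃ H : Fin n → M, ∀ i j, MeanderEdge n p i j → H j = H i + weight i j := by
  obtain ⟨σ, σ_injective, hσ⟩ := exists_injective_meanderEdge_one (by omega) hcop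
  refine exists_potential (Fin.val_injective.comp (zigzag_injective.comp σ_injective))
    (fun i j hij => ?_) (fun i j => MeanderEdge.asymm hp hpn) weight
  simpa only [meanderEdge_one_iff, Function.comp_apply, eq_comm] using hσ i j hij

end Meander

section Order

variable {n p : ℕ}

theorem exists_perm_lt_iff {α : Type*} [LinearOrder α] {key : Fin n → α}
    (hkey : Function.Injective key) :
    ∃ e : Equiv.Perm (Fin n), ∀ i j, e.symm i < e.symm j ↔ key i < key j := by
  have sorted : StrictMono (key ∘ Tuple.sort key) :=
    (Tuple.monotone_sort key).strictMono_of_injective (hkey.comp (Equiv.injective _))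
  refine ⟨Tuple.sort key, fun i j => ?_⟩
  rw [← sorted.lt_iff_lt, Function.comp_apply, Function.comp_apply, Equiv.apply_symm_apply,
    Equiv.apply_symm_apply]

/-- If every class of `cls` is a chain of `E`, ordered by `pos`, the chains can be concatenated in
the order of their classes. -/
theorem exists_perm_concatenating_chains {α β : Type*} [LinearOrder α] [LinearOrder β]
    {cls : Fin n → α} {pos : Fin n → β} (hpos : Function.Injective pos) {E : Fin n → Fin n → Prop}
    (hE : ∀ v w, E v w → cls v = cls w ∧ pos v < pos w)
    (hnext : ∀ v w, cls v = cls w → pos v < pos w → ∃ u, E v u ∧ pos u ≤ pos w) :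
    ∃ e : Equiv.Perm (Fin n), (∀ i j, cls i < cls j ∨ E i j → e.symm i < e.symm j) ∧
      ∀ s t : Fin n, (s : ℕ) + 1 = t → E (e s) (e t) ∨
        cls (e s) < cls (e t) ∧ (∀ u, ¬ E (e s) u) ∧ ∀ u, ¬ E u (e t) := by
  let key : Fin n → α ×ₗ β := fun v => toLex (cls v, pos v)
  have key_injective : Function.Injective key := fun v w hvw =>
    hpos (Prod.mk.inj (toLex.injective hvw)).2
  have key_lt {v w : Fin n} : key v < key w ↔ cls v < cls w ∨ cls v = cls w ∧ pos v < pos w :=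
    Prod.Lex.toLex_lt_toLex
  have key_lt_of_edge {v w : Fin n} (h : E v w) : key v < key w := key_lt.mpr (Or.inr (hE v w h))
  obtain ⟨e, he⟩ := exists_perm_lt_iff key_injective
  refine ⟨e, fun i j hij => (he i j).mpr ?_, fun s t hst => ?_⟩
  · exact hij.elim (fun h => key_lt.mpr (Or.inl h)) key_lt_of_edge
  have lt_st : key (e s) < key (e t) := by
    rw [← he, Equiv.symm_apply_apply, Equiv.symm_apply_apply, Fin.lt_def]
    omega
  have not_between {u : Fin n} (hsu : key (e s) < key u) : ¬ key u < key (e t) := by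
    intro hut
    rw [← he, Equiv.symm_apply_apply, Fin.lt_def] at hsu hut
    omega
  obtain hcls | ⟨hcls, hlt⟩ := key_lt.mp lt_st
  · refine Or.inr ⟨hcls, fun u hu => not_between (key_lt_of_edge hu) (key_lt.mpr (Or.inl ?_)),
      fun u hu => not_between (key_lt.mpr (Or.inl ?_)) (key_lt_of_edge hu)⟩
    · rwa [← (hE _ _ hu).1]
    · rwa [(hE _ _ hu).1]
  · obtain ⟨u, hu, hut⟩ := hnext _ _ hcls hlt
    obtain hut | hut := hut.lt_or_eq
    · exact absurd (key_lt.mpr (Or.inr ⟨(hE _ _ hu).1.symm.trans hcls, hut⟩))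
        (not_between (key_lt_of_edge hu))
    · exact Or.inl (hpos hut ▸ hu)

/-- The total order of the vertices of the meander graph given by `e` increases along the non-simple
edges, and two successive vertices are joined by such an edge or go from the second block to the
first. -/
structure IsAdapted (p : ℕ) (e : Equiv.Perm (Fin n)) : Prop where
  lt : ∀ i j, MeanderEdge n p i j → ¬ IsSimpleUpToSign (i, j) → e.symm i < e.symm j
  succ : ∀ s t : Fin n, (s : ℕ) + 1 = t →
    (MeanderEdge n p (e s) (e t) ∧ ¬ IsSimpleUpToSign (e s, e t)) ∨
      (p ≤ (e s : ℕ) ∧ (e t : ℕ) < p)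

/-- The edges of the meander graph that go back and forth between the two halves of the vertices,
the vertex `n / 2` counting in the first half. -/
def IsChainEdge (p : ℕ) (i j : Fin n) : Prop :=
  (2 * (i : ℕ) ≤ n ∧ n < 2 * (j : ℕ) ∧ (i : ℕ) + j + 1 = n) ∨
    (n < 2 * (i : ℕ) ∧ 2 * (j : ℕ) ≤ n ∧ (i : ℕ) + j + 1 = n + p)

theorem IsChainEdge.meanderEdge (hpn : 2 * p < n) {i j : Fin n} (h : IsChainEdge p i j) :
    MeanderEdge n p i j := by
  simp only [IsChainEdge] at h
  simp only [MeanderEdge]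
  omega

theorem IsChainEdge.not_isSimpleUpToSign (hp : 2 ≤ p) (hcop : Nat.Coprime p n) {i j : Fin n}
    (h : IsChainEdge p i j) : ¬ IsSimpleUpToSign (i, j) := by
  have parity := odd_or_odd_of_coprime hcop
  simp only [IsChainEdge] at h
  simp only [IsSimpleUpToSign]
  omega

/-- The index of a vertex modulo the symmetry `v ↦ n - 1 - v`, the vertex `n / 2` counting in the
first half. -/
def foldIndex (v : Fin n) : ℕ :=
  if 2 * (v : ℕ) ≤ n then v else n - 1 - v

theorem IsChainEdge.foldIndex_mod_eq {i j : Fin n} (h : IsChainEdge p i j) :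
    foldIndex i % p = foldIndex j % p := by
  obtain hj | hj : foldIndex j = foldIndex i ∨ foldIndex j = foldIndex i + p := by
    simp only [IsChainEdge] at h
    simp only [foldIndex]
    split_ifs <;> omega
  · rw [hj]
  · rw [hj, Nat.add_mod_right]

theorem IsChainEdge.zigzag_lt (hp : 2 ≤ p) {i j : Fin n} (h : IsChainEdge p i j) :
    zigzag i < zigzag j := by
  rw [Fin.lt_def, val_zigzag, val_zigzag]
  simp only [IsChainEdge] at h
  split_ifs <;> omega

theorem add_le_of_mod_eq {a b : ℕ} (hmod : a % p = b % p) (hab : a < b) : a + p ≤ b := by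
  have := Nat.le_of_dvd (by omega) ((Nat.modEq_iff_dvd' hab.le).mp hmod)
  omega

theorem exists_isChainEdge_zigzag_le (hp : 2 ≤ p) {v w : Fin n}
    (hmod : foldIndex v % p = foldIndex w % p) (hvw : zigzag v < zigzag w) :
    ∃ u, IsChainEdge p v u ∧ zigzag u ≤ zigzag w := by
  have add_le := add_le_of_mod_eq hmod
  simp only [Fin.lt_def, Fin.le_def, val_zigzag] at hvw ⊢
  simp only [foldIndex, IsChainEdge] at add_le ⊢
  by_cases hv : 2 * (v : ℕ) ≤ n
  · refine ⟨v.rev, ?_⟩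
    rw [Fin.val_rev]
    split_ifs at * <;> omega
  · refine ⟨⟨n - 1 - v + p, by split_ifs at * <;> omega⟩, ?_⟩
    simp only
    split_ifs at * <;> omega

theorem exists_isChainEdge_of_lt (hpn : 2 * p < n) {v : Fin n} (hv : (v : ℕ) < p) :
    ∃ u, IsChainEdge p v u := by
  refine ⟨v.rev, ?_⟩
  simp only [IsChainEdge, Fin.val_rev]
  omega

theorem exists_isChainEdge_of_le (hp : 2 ≤ p) (hpn : 2 * p < n) {w : Fin n} (hw : p ≤ (w : ℕ)) :
    ∃ u, IsChainEdge p u w := by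
  simp only [IsChainEdge]
  obtain hlow | hhigh := le_or_gt (2 * (w : ℕ)) n
  · exact ⟨⟨n - 1 + p - w, by omega⟩, by simp only; omega⟩
  · exact ⟨w.rev, by rw [Fin.val_rev]; omega⟩

/-- The potential `H` is constant on the chains and increases along all the other edges. -/
theorem exists_isAdapted_of_two_mul_lt (hp : 2 ≤ p) (hpn : 2 * p < n) (hcop : Nat.Coprime p n) :
    ∃ e : Equiv.Perm (Fin n), IsAdapted p e ∧
      ∀ i j, MeanderEdge n p i j → e.symm i < e.symm j := by
  classical
  obtain ⟨H, hH⟩ := exists_meander_potential (by omega) (by omega) hcop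
    (fun i j => if IsChainEdge p i j then (0 : ℤ) else 1)
  obtain ⟨e, lt_of_lt_or_chain, succ⟩ := exists_perm_concatenating_chains
    (cls := fun v => toLex (H v, foldIndex v % p)) (pos := zigzag) (E := IsChainEdge p)
    zigzag_injective
    (fun v w h => ⟨by rw [hH v w (h.meanderEdge hpn), if_pos h, add_zero, h.foldIndex_mod_eq],
      h.zigzag_lt hp⟩)
    (fun v w hcls hvw =>
      exists_isChainEdge_zigzag_le hp (Prod.mk.inj (toLex.injective hcls)).2 hvw)
  have lt_of_edge (i j : Fin n) (hij : MeanderEdge n p i j) : e.symm i < e.symm j := by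
    by_cases hchain : IsChainEdge p i j
    · exact lt_of_lt_or_chain i j (Or.inr hchain)
    · refine lt_of_lt_or_chain i j (Or.inl (Prod.Lex.toLex_lt_toLex.mpr (Or.inl ?_)))
      rw [hH i j hij, if_neg hchain]
      exact lt_add_one _
  refine ⟨e, ⟨fun i j hij _ => lt_of_edge i j hij, fun s t hst => ?_⟩, lt_of_edge⟩
  refine (succ s t hst).imp (fun h => ⟨h.meanderEdge hpn, h.not_isSimpleUpToSign hp hcop⟩) ?_
  rintro ⟨-, last, first⟩
  refine ⟨not_lt.mp fun hs => ?_, not_le.mp fun ht => ?_⟩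
  · exact (exists_isChainEdge_of_lt hpn hs).elim last
  · exact (exists_isChainEdge_of_le hp hpn ht).elim first

theorem isSimpleUpToSign_iff_zigzag {i j : Fin n} (h : MeanderEdge n 1 i j) :
    IsSimpleUpToSign (i, j) ↔ (zigzag j : ℕ) + 1 = n := by
  rw [val_zigzag]
  simp only [MeanderEdge, IsSimpleUpToSign] at h ⊢
  split_ifs <;> omega

theorem zigzag_surjective : Function.Surjective (zigzag (n := n)) :=
  Finite.surjective_of_injective zigzag_injective

theorem exists_meanderEdge_one_from {v : Fin n} (hv : (zigzag v : ℕ) + 1 < n) :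
    ∃ u, MeanderEdge n 1 v u :=
  (zigzag_surjective ⟨zigzag v + 1, hv⟩).imp fun _ hu =>
    meanderEdge_one_iff.mpr (congrArg Fin.val hu).symm

theorem exists_meanderEdge_one_to {w : Fin n} (hw : (zigzag w : ℕ) ≠ 0) :
    ∃ u, MeanderEdge n 1 u w := by
  obtain ⟨u, hu⟩ := zigzag_surjective (n := n) ⟨zigzag w - 1, by omega⟩
  refine ⟨u, meanderEdge_one_iff.mpr ?_⟩
  have : (zigzag u : ℕ) = zigzag w - 1 := congrArg Fin.val hu
  omega

/-- The only simple edge is the last one of the path, so the end of the path can be moved to the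
front. -/
theorem exists_isAdapted_one (hn : 2 ≤ n) : ∃ e : Equiv.Perm (Fin n), IsAdapted 1 e := by
  let E : Fin n → Fin n → Prop := fun v w => MeanderEdge n 1 v w ∧ (zigzag w : ℕ) + 1 ≠ n
  let cls : Fin n → ℕ := fun v => if (zigzag v : ℕ) + 1 = n then 0 else 1
  have cls_zigzag (v w : Fin n) (hE : E v w) : cls v = cls w ∧ zigzag v < zigzag w := by
    have hvw := meanderEdge_one_iff.mp hE.1
    exact ⟨by simp only [cls]; rw [if_neg (by omega), if_neg hE.2], by rw [Fin.lt_def]; omega⟩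
  have next (v w : Fin n) (hcls : cls v = cls w) (hvw : zigzag v < zigzag w) :
      ∃ u, E v u ∧ zigzag u ≤ zigzag w := by
    rw [Fin.lt_def] at hvw
    have hw : (zigzag w : ℕ) + 1 ≠ n := fun h => by
      simp only [cls] at hcls
      rw [if_neg (by omega), if_pos h] at hcls
      omega
    obtain ⟨u, hvu⟩ := exists_meanderEdge_one_from (v := v) (by omega)
    have hu := meanderEdge_one_iff.mp hvu
    exact ⟨u, ⟨hvu, by omega⟩, by rw [Fin.le_def]; omega⟩
  obtain ⟨e, lt_of_lt_or_edge, succ⟩ :=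
    exists_perm_concatenating_chains zigzag_injective cls_zigzag next
  refine ⟨e, fun i j hij hsimple => lt_of_lt_or_edge i j (Or.inr ⟨hij, ?_⟩), fun s t hst => ?_⟩
  · rwa [isSimpleUpToSign_iff_zigzag hij] at hsimple
  refine (succ s t hst).imp (fun h => ⟨h.1, (isSimpleUpToSign_iff_zigzag h.1).not.mpr h.2⟩) ?_
  rintro ⟨hcls, -, first⟩
  have hs : (zigzag (e s) : ℕ) + 1 = n := by_contra fun h => by
    simp only [cls, if_neg h] at hcls
    split_ifs at hcls <;> omega
  have ht : (zigzag (e t) : ℕ) = 0 := by_contra fun h => by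
    obtain ⟨u, hu⟩ := exists_meanderEdge_one_to h
    have ht : (zigzag (e t) : ℕ) + 1 ≠ n := fun h' => by
      simp only [cls, if_pos h'] at hcls
      omega
    exact first u ⟨hu, ht⟩
  rw [val_zigzag] at hs ht
  constructor
  · split_ifs at hs <;> omega
  · split_ifs at ht
    omega

/-- The image of the opposite of the total order `e` under the reversal of the indices. -/
def dualOrder (e : Equiv.Perm (Fin n)) : Equiv.Perm (Fin n) :=
  Fin.revPerm.trans (e.trans Fin.revPerm)

theorem dualOrder_apply (e : Equiv.Perm (Fin n)) (s : Fin n) : dualOrder e s = (e s.rev).rev := rfl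

theorem dualOrder_symm_apply (e : Equiv.Perm (Fin n)) (i : Fin n) :
    (dualOrder e).symm i = (e.symm i.rev).rev := rfl

theorem IsAdapted.dual (hpn : p ≤ n) {e : Equiv.Perm (Fin n)} (h : IsAdapted p e) :
    IsAdapted (n - p) (dualOrder e) where
  lt i j hij hsimple := by
    rw [dualOrder_symm_apply, dualOrder_symm_apply, Fin.rev_lt_rev]
    exact h.lt _ _ ((meanderEdge_sub_iff_rev hpn).mp hij)
      (isSimpleUpToSign_iff_rev.not.mp hsimple)
  succ s t hst := by
    rw [meanderEdge_sub_iff_rev hpn, isSimpleUpToSign_iff_rev, dualOrder_apply, dualOrder_apply,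
      Fin.rev_rev, Fin.rev_rev, Fin.val_rev, Fin.val_rev]
    refine (h.succ t.rev s.rev (by rw [Fin.val_rev, Fin.val_rev]; omega)).imp_right ?_
    omega

theorem exists_isAdapted_of_two_le (hp : 2 ≤ p) (hpn : p + 2 ≤ n) (hcop : Nat.Coprime p n) :
    ∃ e : Equiv.Perm (Fin n), IsAdapted p e ∧
      ∀ i j, MeanderEdge n p i j → e.symm i < e.symm j := by
  have two_mul_ne : 2 * p ≠ n := fun h => by
    have := Nat.Coprime.eq_one_of_dvd hcop (Dvd.intro_left 2 h)
    omega
  obtain h | h := two_mul_ne.lt_or_gt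
  · exact exists_isAdapted_of_two_mul_lt hp h hcop
  obtain ⟨q, rfl⟩ : ∃ q, p = n - q := ⟨n - p, by omega⟩
  obtain ⟨e, adapted, lt_of_edge⟩ := exists_isAdapted_of_two_mul_lt (n := n) (p := q)
    (by omega) (by omega) ((Nat.coprime_self_sub_left (by omega)).mp hcop)
  refine ⟨dualOrder e, adapted.dual (by omega), fun i j hij => ?_⟩
  rw [dualOrder_symm_apply, dualOrder_symm_apply, Fin.rev_lt_rev]
  exact lt_of_edge _ _ ((meanderEdge_sub_iff_rev (by omega)).mp hij)

theorem exists_isAdapted (hn : 2 ≤ n) (hp : p = 1 ∨ p = n - 1) :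
    ∃ e : Equiv.Perm (Fin n), IsAdapted p e := by
  obtain ⟨e, adapted⟩ := exists_isAdapted_one hn
  obtain rfl | rfl := hp
  · exact ⟨e, adapted⟩
  · exact ⟨_, adapted.dual (by omega)⟩

/-- The meander graph is the oriented path through the vertices in the order `e`. -/
def IsOrientedPath (p : ℕ) (e : Equiv.Perm (Fin n)) : Prop :=
  ∀ i j, MeanderEdge n p i j ↔ (e.symm i : ℕ) + 1 = e.symm j

theorem exists_isOrientedPath (hn : 2 ≤ n) (hp : p = 1 ∨ p = n - 1) :
    ∃ e : Equiv.Perm (Fin n), IsOrientedPath p e := by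
  let e := (Equiv.ofBijective zigzag ⟨zigzag_injective (n := n), zigzag_surjective⟩).symm
  have path : IsOrientedPath 1 e := fun i j => meanderEdge_one_iff
  obtain rfl | rfl := hp
  · exact ⟨e, path⟩
  · refine ⟨dualOrder e, fun i j => ?_⟩
    rw [meanderEdge_sub_iff_rev (by omega), path, dualOrder_symm_apply, dualOrder_symm_apply,
      Fin.val_rev, Fin.val_rev]
    omega

end Order

section Truncation

variable {k : Type*} [Field k] {a : Type*} [LieRing a] [LieAlgebra k a]

/-- Weights of semi-invariants vanish on brackets. -/
theorem mem_truncation_of_lie_eq_smul {u v : a} {c : k} (hc : c ≠ 0) (h : ⁅u, v⁆ = c • v) :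
    v ∈ truncation k a := by
  intro χ F hF
  have lie_eq_zero : χ ⁅u, v⁆ • F = 0 := by
    rw [← hF.2, adS_lie, hF.2, hF.2, Derivation.map_smul, Derivation.map_smul, hF.2, hF.2,
      smul_comm, sub_self]
  rw [h, map_smul, smul_eq_mul, mul_smul] at lie_eq_zero
  exact (smul_eq_zero.mp ((smul_eq_zero.mp lie_eq_zero).resolve_left hc)).resolve_right hF.1

end Truncation

section Biparabolic

variable {k : Type*} [Field k] {n p : ℕ}

theorem mem_biparabolic_iff {x : sl (Fin n) k} :
    x ∈ biparabolic k n (simpleRoots n) (simpleRoots n \ {p}) ↔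
      ∀ i j : Fin n, (i : ℕ) < p → p ≤ (j : ℕ) → x.val i j = 0 := by
  refine ⟨fun hx i j hi hj => hx.1 i j ?_, fun hx => ⟨fun i j hij => ?_, fun i j hij => ?_⟩⟩
  · rintro (hji | supported)
    · rw [Fin.le_def] at hji
      omega
    · exact (supported p hi hj).2 rfl
  · simp only [SupportedIn, simpleRoots, Set.mem_sdiff, Set.mem_Ico, Set.mem_singleton_iff] at hij
    push Not at hij
    obtain ⟨-, l, hil, hlj, hl⟩ := hij
    have := hl (by omega)
    exact hx i j (by omega) (by omega)
  · exact absurd (Or.inr fun l hjl hli => ⟨by omega, by omega⟩) hij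

theorem rootVector_val {γ : Fin n × Fin n} (hγ : γ.1 ≠ γ.2) :
    (rootVector k γ).val = Matrix.single γ.1 γ.2 1 := by
  rw [rootVector, dif_pos hγ, val_single]

theorem rootVector_val_apply {γ : Fin n × Fin n} (hγ : γ.1 ≠ γ.2) (i j : Fin n) :
    (rootVector k γ).val i j = if (i, j) = γ then 1 else 0 := by
  rw [rootVector_val hγ, Matrix.single_apply]
  simp only [Prod.ext_iff, eq_comm]

theorem lie_singleSubSingle_rootVector {γ : Fin n × Fin n} (hγ : γ.1 ≠ γ.2) :
    ⁅singleSubSingle γ.1 γ.2 (1 : k), rootVector k γ⁆ = (2 : k) • rootVector k γ := by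
  apply Subtype.ext
  rw [sl_bracket, val_singleSubSingle]
  change _ = (2 : k) • (rootVector k γ).val
  rw [rootVector_val hγ, sub_mul, mul_sub, Matrix.single_mul_single_same,
    Matrix.single_mul_single_of_ne _ _ _ _ hγ.symm, Matrix.single_mul_single_of_ne _ _ _ _ hγ.symm,
    Matrix.single_mul_single_same, two_smul]
  simp

/-- The root vector is an eigenvector of the coroot, which lies in the biparabolic. -/
theorem exists_mem_truncatedBiparabolic [CharZero k] {γ : Fin n × Fin n} (hγ : γ.1 ≠ γ.2)
    (hγp : p ≤ (γ.1 : ℕ) ∨ (γ.2 : ℕ) < p) :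
    ∃ u : truncatedBiparabolic k n (simpleRoots n) (simpleRoots n \ {p}),
      u.1.1 = rootVector k γ := by
  let q := biparabolic k n (simpleRoots n) (simpleRoots n \ {p})
  have rootVector_mem : rootVector k γ ∈ q := mem_biparabolic_iff.mpr fun i j hi hj => by
    rw [rootVector_val_apply hγ, if_neg]
    rintro rfl
    simp only at hγp
    omega
  have coroot_mem : singleSubSingle γ.1 γ.2 (1 : k) ∈ q :=
    mem_biparabolic_iff.mpr fun i j hi hj => by
    have hij : i ≠ j := by
      rintro rfl
      omega
    rw [val_singleSubSingle, Matrix.sub_apply, Matrix.single_apply_of_ne,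
      Matrix.single_apply_of_ne, sub_zero] <;>
    · rintro ⟨rfl, rfl⟩
      exact hij rfl
  exact ⟨⟨⟨_, rootVector_mem⟩, mem_truncation_of_lie_eq_smul (u := ⟨_, coroot_mem⟩)
    (two_ne_zero (α := k)) (Subtype.ext (lie_singleSubSingle_rootVector hγ))⟩, rfl⟩

theorem restriction_killingForm_eq_zero {y : sl (Fin n) k}
    (hy : ∀ i j, y.val i j ≠ 0 → p ≤ (i : ℕ) ∧ (j : ℕ) < p) :
    restriction k n (simpleRoots n) (simpleRoots n \ {p}) (killingForm k (sl (Fin n) k) y) = 0 := by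
  refine LinearMap.ext fun u => ?_
  change killingForm k (sl (Fin n) k) y u.1.1 = 0
  rw [killingForm_sl, Matrix.trace]
  refine mul_eq_zero_of_right _ (Finset.sum_eq_zero fun i _ => ?_)
  rw [Matrix.diag_apply, Matrix.mul_apply]
  refine Finset.sum_eq_zero fun j _ => ?_
  by_cases hij : y.val i j = 0
  · rw [hij, zero_mul]
  · rw [mem_biparabolic_iff.mp u.1.2 j i (hy i j hij).2 (hy i j hij).1, mul_zero]

theorem killingForm_rootVector (x : sl (Fin n) k) {γ : Fin n × Fin n} (hγ : γ.1 ≠ γ.2) :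
    killingForm k (sl (Fin n) k) x (rootVector k γ) = 2 * n * x.val γ.2 γ.1 := by
  rw [killingForm_sl, rootVector_val hγ, Matrix.trace_mul_single, MulOpposite.op_one, one_smul,
    Fintype.card_fin]

theorem killingForm_rootVector_ne_zero [CharZero k] {γ : Fin n × Fin n} (hγ : γ.1 ≠ γ.2) :
    killingForm k (sl (Fin n) k) (rootVector k γ) ≠ 0 := by
  refine (map_ne_zero_iff _ killingForm_sl_injective).mpr fun h => ?_
  simpa [h] using rootVector_val_apply (k := k) hγ γ.1 γ.2

end Biparabolic

section Weierstrass

variable {k : Type*} [Field k] {n p : ℕ} {γ : Fin n × Fin n}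

/-- The matrix `η + c x_γ`, which represents a point of the line `𝒲`. -/
def weierstrassMatrix (p : ℕ) (γ : Fin n × Fin n) (c : k) : sl (Fin n) k :=
  eta k (simpleRoots n) (simpleRoots n \ {p}) γ + c • rootVector k γ

open Classical in
theorem weierstrassMatrix_val_apply (hpn : p ≤ n) (hγ : γ.1 ≠ γ.2) (c : k) (i j : Fin n) :
    (weierstrassMatrix p γ c).val i j =
      if (i, j) = γ then c else if MeanderEdge n p i j then 1 else 0 := by
  let entry : sl (Fin n) k →ₗ[k] k :=
    { toFun := fun x => x.val i j, map_add' := fun _ _ => rfl, map_smul' := fun _ _ => rfl }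
  have entry_rootVector {δ : Fin n × Fin n} (hδ : δ.1 ≠ δ.2) :
      entry (rootVector k δ) = if (i, j) = δ then 1 else 0 := rootVector_val_apply hδ i j
  have entry_eta : entry (eta k (simpleRoots n) (simpleRoots n \ {p}) γ) =
      if MeanderEdge n p i j ∧ (i, j) ≠ γ then 1 else 0 := by
    rw [eta, map_sum, Finset.sum_congr rfl fun δ hδ => entry_rootVector
      ((mem_cascadeRoots_iff hpn).mp (Finset.mem_filter.mp hδ).2.1).ne, Finset.sum_ite_eq]
    simp only [Finset.mem_filter, Finset.mem_univ, true_and, mem_cascadeRoots_iff hpn]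
  change entry (_ + c • _) = _
  rw [map_add, map_smul, entry_eta, entry_rootVector hγ]
  split_ifs <;> simp_all

theorem weierstrassMatrix_val_eq_zero (hpn : p ≤ n) (hγ : MeanderEdge n p γ.1 γ.2) (c : k)
    {i j : Fin n} (hij : ¬ MeanderEdge n p i j) : (weierstrassMatrix p γ c).val i j = 0 := by
  rw [weierstrassMatrix_val_apply hpn hγ.ne, if_neg hij, if_neg]
  rintro rfl
  exact hij hγ

theorem MeanderEdge.lt_or_le {i j : Fin n} (h : MeanderEdge n p i j) :
    (i : ℕ) < p ∨ p ≤ (j : ℕ) := by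
  simp only [MeanderEdge] at h
  omega

theorem weierstrass_injective [CharZero k] (hpn : p ≤ n) (hγ : MeanderEdge n p γ.1 γ.2) :
    Function.Injective fun c : k =>
      restriction k n (simpleRoots n) (simpleRoots n \ {p})
        (killingForm k (sl (Fin n) k) (weierstrassMatrix p γ c)) := by
  obtain ⟨u, hu⟩ := exists_mem_truncatedBiparabolic (k := k) (p := p) (γ := (γ.2, γ.1)) hγ.ne.symm
    hγ.lt_or_le.symm
  have eval_u (c : k) : restriction k n (simpleRoots n) (simpleRoots n \ {p})
      (killingForm k (sl (Fin n) k) (weierstrassMatrix p γ c)) u = 2 * n * c := by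
    change killingForm k (sl (Fin n) k) _ u.1.1 = _
    rw [hu, killingForm_rootVector _ hγ.ne.symm, weierstrassMatrix_val_apply hpn hγ.ne, if_pos rfl]
  intro c d hcd
  have hn : (2 * n : k) ≠ 0 := mul_ne_zero two_ne_zero (Nat.cast_ne_zero.mpr γ.1.pos.ne')
  exact mul_left_cancel₀ hn (by simpa only [eval_u] using LinearMap.congr_fun hcd u)

theorem bijOn_weierstrassLine [CharZero k] (hpn : p ≤ n) (hγ : MeanderEdge n p γ.1 γ.2)
    {X : k → sl (Fin n) k} (hX : ∀ c i j, (X c - weierstrassMatrix p γ c).val i j ≠ 0 →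
      p ≤ (i : ℕ) ∧ (j : ℕ) < p) :
    Set.BijOn (restriction k n (simpleRoots n) (simpleRoots n \ {p}))
      (Set.range fun c => killingForm k (sl (Fin n) k) (X c))
      (weierstrassLine k (simpleRoots n) (simpleRoots n \ {p}) γ) := by
  have restriction_eq (c : k) : restriction k n (simpleRoots n) (simpleRoots n \ {p})
      (killingForm k (sl (Fin n) k) (X c)) = restriction k n (simpleRoots n) (simpleRoots n \ {p})
        (killingForm k (sl (Fin n) k) (weierstrassMatrix p γ c)) := by
    rw [← sub_eq_zero, ← map_sub, ← map_sub]
    exact restriction_killingForm_eq_zero (hX c)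
  refine ⟨?_, ?_, ?_⟩
  · rintro _ ⟨c, rfl⟩
    exact ⟨c, (restriction_eq c).symm⟩
  · rintro _ ⟨c, rfl⟩ _ ⟨d, rfl⟩ hcd
    simp only [restriction_eq] at hcd
    rw [weierstrass_injective hpn hγ hcd]
  · rintro _ ⟨c, rfl⟩
    exact ⟨_, ⟨c, rfl⟩, restriction_eq c⟩

variable {e : Equiv.Perm (Fin n)}

open Classical in
/-- The sum of the matrix units from the second block to the first at two successive indices of the
total order `e`. It restricts to zero on the truncated biparabolic, and it completes the points of
`𝒲` to regular nilpotent matrices. -/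
def link (k : Type*) [Field k] (p : ℕ) (e : Equiv.Perm (Fin n)) : sl (Fin n) k :=
  ⟨Matrix.of fun i j => if p ≤ (i : ℕ) ∧ (j : ℕ) < p ∧ (e.symm i : ℕ) + 1 = e.symm j
    then 1 else 0, by
    change Matrix.trace (Matrix.of fun i j : Fin n =>
      if p ≤ (i : ℕ) ∧ (j : ℕ) < p ∧ (e.symm i : ℕ) + 1 = e.symm j then (1 : k) else 0) = 0
    exact Finset.sum_eq_zero fun i _ => by simp⟩

open Classical in
theorem link_val_apply (i j : Fin n) :
    (link k p e).val i j = if p ≤ (i : ℕ) ∧ (j : ℕ) < p ∧ (e.symm i : ℕ) + 1 = e.symm j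
      then 1 else 0 := rfl

theorem link_val_ne_zero_iff {i j : Fin n} : (link k p e).val i j ≠ 0 ↔
    p ≤ (i : ℕ) ∧ (j : ℕ) < p ∧ (e.symm i : ℕ) + 1 = e.symm j := by
  rw [link_val_apply]
  split_ifs with h <;> simp [h]

theorem MeanderEdge.link_val_eq_zero {i j : Fin n} (h : MeanderEdge n p i j) :
    (link k p e).val i j = 0 := by
  refine not_not.mp (link_val_ne_zero_iff.not.mpr fun hlink => ?_)
  have := h.lt_or_le
  omega

theorem IsAdapted.weierstrassMatrix_add_link_ne_zero (he : IsAdapted p e) (hpn : p ≤ n)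
    (hγ : MeanderEdge n p γ.1 γ.2) (hsimple : IsSimpleUpToSign γ) (c : k) {s t : Fin n}
    (hst : (s : ℕ) + 1 = t) : (weierstrassMatrix p γ c + link k p e).val (e s) (e t) ≠ 0 := by
  change (weierstrassMatrix p γ c).val _ _ + (link k p e).val _ _ ≠ 0
  obtain ⟨hedge, hnot⟩ | ⟨hs, ht⟩ := he.succ s t hst
  · have hne : (e s, e t) ≠ γ := by
      rintro rfl
      exact hnot hsimple
    rw [hedge.link_val_eq_zero, add_zero, weierstrassMatrix_val_apply hpn hγ.ne, if_neg hne,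
      if_pos hedge]
    exact one_ne_zero
  · have hnot : ¬ MeanderEdge n p (e s) (e t) := fun h => by
      have := h.lt_or_le
      omega
    rw [weierstrassMatrix_val_eq_zero hpn hγ c hnot, zero_add]
    exact link_val_ne_zero_iff.mpr ⟨hs, ht, by simpa using hst⟩

theorem IsAdapted.killingForm_mem_regNullcone [CharZero k] (he : IsAdapted p e) (hpn : p ≤ n)
    (hγ : MeanderEdge n p γ.1 γ.2) (hsimple : IsSimpleUpToSign γ) {c : k}
    (htri : IsTriangularFor e (weierstrassMatrix p γ c).val) :
    killingForm k (sl (Fin n) k) (weierstrassMatrix p γ c + link k p e) ∈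
      regNullcone k (sl (Fin n) k) := by
  refine (IsTriangularFor.mem_regNullcone_iff (e := e) fun i j hij => ?_).mpr fun s t hst =>
    he.weierstrassMatrix_add_link_ne_zero hpn hγ hsimple c hst
  by_cases hW : (weierstrassMatrix p γ c).val i j = 0
  · have hlink : (link k p e).val i j ≠ 0 := fun h => hij (by
      change (weierstrassMatrix p γ c).val i j + (link k p e).val i j = 0
      rw [hW, h, add_zero])
    rw [Fin.lt_def, ← (link_val_ne_zero_iff.mp hlink).2.2]
    exact Nat.lt_succ_self _
  · exact htri i j hW

theorem IsOrientedPath.killingForm_mem_regNullcone_iff [CharZero k] (he : IsOrientedPath p e)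
    (hpn : p ≤ n) (hγ : MeanderEdge n p γ.1 γ.2) {c : k} :
    killingForm k (sl (Fin n) k) (weierstrassMatrix p γ c) ∈ regNullcone k (sl (Fin n) k) ↔
      c ≠ 0 := by
  have triangular : IsTriangularFor e (weierstrassMatrix p γ c).val := fun i j hij => by
    have hedge := (he i j).mp (not_not.mp (mt (weierstrassMatrix_val_eq_zero hpn hγ c) hij))
    rw [Fin.lt_def]
    omega
  rw [triangular.mem_regNullcone_iff]
  constructor
  · intro h
    simpa [weierstrassMatrix_val_apply hpn hγ.ne] using h _ _ ((he _ _).mp hγ)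
  · intro hc s t hst
    have hedge : MeanderEdge n p (e s) (e t) := (he _ _).mpr (by simpa using hst)
    rw [weierstrassMatrix_val_apply hpn hγ.ne, if_pos hedge]
    split_ifs
    exacts [hc, one_ne_zero]

theorem killingForm_weierstrassMatrix_add (y : sl (Fin n) k) :
    (fun c : k => killingForm k (sl (Fin n) k) (weierstrassMatrix p γ c + y)) =
      fun c => killingForm k (sl (Fin n) k) (weierstrassMatrix p γ 0 + y) +
        c • killingForm k (sl (Fin n) k) (rootVector k γ) := by
  funext c
  rw [weierstrassMatrix, weierstrassMatrix, zero_smul, add_zero, add_right_comm,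
    map_add _ (_ + y), map_smul]

end Weierstrass

section WeierstrassSection

variable {k : Type*} [Field k] {n p : ℕ} {γ : Fin n × Fin n} {e : Equiv.Perm (Fin n)}

theorem isClosed_range_killingForm_weierstrassMatrix_add (y : sl (Fin n) k) :
    @IsClosed _ (zariski k (sl (Fin n) k)) (Set.range fun c : k =>
      killingForm k (sl (Fin n) k) (weierstrassMatrix p γ c + y)) := by
  rw [killingForm_weierstrassMatrix_add]
  exact isClosed_line _ _

theorem isIrred_image_killingForm_weierstrassMatrix_add {S : Set k} (hS : S.Infinite)
    (y : sl (Fin n) k) : IsIrred k _ ((fun c : k =>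
      killingForm k (sl (Fin n) k) (weierstrassMatrix p γ c + y)) '' S) := by
  rw [killingForm_weierstrassMatrix_add]
  exact isIrred_line hS

variable [CharZero k]

theorem dimension_image_killingForm_weierstrassMatrix_add_union (hγ : γ.1 ≠ γ.2) {S : Set k}
    (hS : S.Infinite) (y : sl (Fin n) k) {E : Set (Module.Dual k (sl (Fin n) k))} (hE : E.Finite) :
    dimension k _ ((fun c : k =>
      killingForm k (sl (Fin n) k) (weierstrassMatrix p γ c + y)) '' S ∪ E) = 1 := by
  rw [killingForm_weierstrassMatrix_add]
  exact dimension_line_union (killingForm_rootVector_ne_zero hγ) hS hE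

theorem exists_line_over_weierstrass (hp : 2 ≤ p) (hpn : p + 2 ≤ n) (hcop : Nat.Coprime p n)
    (hγ : MeanderEdge n p γ.1 γ.2) (hsimple : IsSimpleUpToSign γ) :
    ∃ Z : Set (Module.Dual k (sl (Fin n) k)),
      IsSubvariety k _ (regNullcone k _) Z ∧ dimension k _ Z = 1 ∧
      Set.BijOn (restriction k n (simpleRoots n) (simpleRoots n \ {p})) Z
        (weierstrassLine k (simpleRoots n) (simpleRoots n \ {p}) γ) ∧ IsIrred k _ Z := by
  have hpn' : p ≤ n := by omega
  obtain ⟨e, adapted, lt_of_edge⟩ := exists_isAdapted_of_two_le hp hpn hcop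
  have triangular (c : k) : IsTriangularFor e (weierstrassMatrix p γ c).val := fun i j hij =>
    lt_of_edge i j (not_not.mp (mt (weierstrassMatrix_val_eq_zero hpn' hγ c) hij))
  have range_subset : (Set.range fun c : k => killingForm k (sl (Fin n) k)
      (weierstrassMatrix p γ c + link k p e)) ⊆ regNullcone k _ := by
    rintro _ ⟨c, rfl⟩
    exact adapted.killingForm_mem_regNullcone hpn' hγ hsimple (triangular c)
  refine ⟨_, ⟨_, isClosed_range_killingForm_weierstrassMatrix_add (link k p e),
    (Set.inter_eq_left.mpr range_subset).symm⟩, ?_, ?_, ?_⟩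
  · rw [← Set.image_univ, ← Set.union_empty (_ '' _)]
    exact dimension_image_killingForm_weierstrassMatrix_add_union hγ.ne Set.infinite_univ _
      Set.finite_empty
  · refine bijOn_weierstrassLine hpn' hγ fun c i j hij => ?_
    rw [add_sub_cancel_left, link_val_ne_zero_iff] at hij
    exact ⟨hij.1, hij.2.1⟩
  · rw [← Set.image_univ]
    exact isIrred_image_killingForm_weierstrassMatrix_add Set.infinite_univ _

theorem IsAdapted.killingForm_weierstrassMatrix_zero_add_link_mem_regNullcone (he : IsAdapted p e)
    (hpn : p ≤ n) (hγ : MeanderEdge n p γ.1 γ.2) (hsimple : IsSimpleUpToSign γ)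
    (huniq : ∀ δ : Fin n × Fin n, MeanderEdge n p δ.1 δ.2 → IsSimpleUpToSign δ → δ = γ) :
    killingForm k (sl (Fin n) k) (weierstrassMatrix p γ 0 + link k p e) ∈
      regNullcone k (sl (Fin n) k) := by
  refine he.killingForm_mem_regNullcone hpn hγ hsimple fun i j hij => ?_
  have hedge : MeanderEdge n p i j :=
    not_not.mp (mt (weierstrassMatrix_val_eq_zero hpn hγ 0) hij)
  refine he.lt i j hedge fun hsimple' => hij ?_
  rw [weierstrassMatrix_val_apply hpn hγ.ne, if_pos (huniq (i, j) hedge hsimple')]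

theorem IsOrientedPath.image_compl_zero_eq (he : IsOrientedPath p e) (hpn : p ≤ n)
    (hγ : MeanderEdge n p γ.1 γ.2) :
    (fun c : k => killingForm k (sl (Fin n) k) (weierstrassMatrix p γ c)) '' {0}ᶜ =
      (Set.range fun c : k => killingForm k (sl (Fin n) k) (weierstrassMatrix p γ c)) ∩
        regNullcone k _ := by
  ext f
  constructor
  · rintro ⟨c, hc, rfl⟩
    exact ⟨⟨c, rfl⟩, (he.killingForm_mem_regNullcone_iff hpn hγ).mpr hc⟩
  · rintro ⟨⟨c, rfl⟩, hf⟩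
    exact ⟨c, (he.killingForm_mem_regNullcone_iff hpn hγ).mp hf, rfl⟩

theorem killingForm_weierstrassMatrix_zero_add_link_notMem (hpn : p ≤ n)
    (hγ : MeanderEdge n p γ.1 γ.2) :
    killingForm k (sl (Fin n) k) (weierstrassMatrix p γ 0 + link k p e) ∉
      (fun c : k => killingForm k (sl (Fin n) k) (weierstrassMatrix p γ c)) '' {0}ᶜ := by
  rintro ⟨c, hc, heq⟩
  have entry_eq : (weierstrassMatrix p γ c).val γ.1 γ.2 =
      (weierstrassMatrix p γ (0 : k)).val γ.1 γ.2 + (link k p e).val γ.1 γ.2 :=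
    congrArg (fun x : sl (Fin n) k => x.val γ.1 γ.2) (killingForm_sl_injective heq)
  rw [weierstrassMatrix_val_apply hpn hγ.ne, weierstrassMatrix_val_apply hpn hγ.ne,
    hγ.link_val_eq_zero, if_pos rfl, if_pos rfl, add_zero] at entry_eq
  exact hc entry_eq

theorem bijOn_image_compl_zero_union_link (hpn : p ≤ n) (hγ : MeanderEdge n p γ.1 γ.2) :
    Set.BijOn (restriction k n (simpleRoots n) (simpleRoots n \ {p}))
      ((fun c : k => killingForm k (sl (Fin n) k) (weierstrassMatrix p γ c)) '' {0}ᶜ ∪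
        {killingForm k (sl (Fin n) k) (weierstrassMatrix p γ 0 + link k p e)})
      (weierstrassLine k (simpleRoots n) (simpleRoots n \ {p}) γ) := by
  classical
  let X : k → sl (Fin n) k :=
    Function.update (weierstrassMatrix p γ) 0 (weierstrassMatrix p γ 0 + link k p e)
  have X_zero : X 0 = weierstrassMatrix p γ 0 + link k p e := Function.update_self _ _ _
  have X_of_ne {c : k} (hc : c ≠ 0) : X c = weierstrassMatrix p γ c :=
    Function.update_of_ne hc _ _
  have image_eq : (fun c : k => killingForm k (sl (Fin n) k) (weierstrassMatrix p γ c)) '' {0}ᶜ =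
      (fun c => killingForm k (sl (Fin n) k) (X c)) '' {0}ᶜ :=
    Set.image_congr fun c hc => by rw [X_of_ne hc]
  rw [image_eq, ← X_zero, ← Set.image_singleton (f := fun c => killingForm k (sl (Fin n) k) (X c)),
    ← Set.image_union, Set.compl_union_self, Set.image_univ]
  refine bijOn_weierstrassLine hpn hγ fun c i j hij => ?_
  by_cases hc : c = 0
  · rw [hc, X_zero, add_sub_cancel_left, link_val_ne_zero_iff] at hij
    exact ⟨hij.1, hij.2.1⟩
  · rw [X_of_ne hc, sub_self] at hij
    exact absurd rfl hij

theorem exists_line_union_point_over_weierstrass (hn : 2 ≤ n) (hp : p = 1 ∨ p = n - 1)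
    (hγ : MeanderEdge n p γ.1 γ.2) (hsimple : IsSimpleUpToSign γ)
    (huniq : ∀ δ : Fin n × Fin n, MeanderEdge n p δ.1 δ.2 → IsSimpleUpToSign δ → δ = γ) :
    ∃ Z : Set (Module.Dual k (sl (Fin n) k)),
      IsSubvariety k _ (regNullcone k _) Z ∧ dimension k _ Z = 1 ∧
      Set.BijOn (restriction k n (simpleRoots n) (simpleRoots n \ {p})) Z
        (weierstrassLine k (simpleRoots n) (simpleRoots n \ {p}) γ) ∧
      ∃ (C : Set (Module.Dual k (sl (Fin n) k))) (z : Module.Dual k (sl (Fin n) k)),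
        IsSubvariety k _ (regNullcone k _) C ∧ IsIrred k _ C ∧ dimension k _ C = 1 ∧
        z ∉ C ∧ Z = C ∪ {z} := by
  have hpn : p ≤ n := by omega
  obtain ⟨e, path⟩ := exists_isOrientedPath hn hp
  obtain ⟨e', adapted⟩ := exists_isAdapted hn hp
  have z_mem := adapted.killingForm_weierstrassMatrix_zero_add_link_mem_regNullcone
    (k := k) hpn hγ hsimple huniq
  have line_closed :=
    isClosed_range_killingForm_weierstrassMatrix_add (k := k) (p := p) (γ := γ) 0
  have compl_zero_infinite : ({0}ᶜ : Set k).Infinite := (Set.finite_singleton 0).infinite_compl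
  have irreducible := isIrred_image_killingForm_weierstrassMatrix_add (p := p) (γ := γ)
    compl_zero_infinite 0
  have dimension_union {E : Set (Module.Dual k (sl (Fin n) k))} (hE : E.Finite) :=
    dimension_image_killingForm_weierstrassMatrix_add_union (p := p) hγ.ne compl_zero_infinite 0 hE
  simp only [add_zero] at line_closed irreducible dimension_union
  have image_eq := path.image_compl_zero_eq (k := k) hpn hγ
  have subvariety : IsSubvariety k _ (regNullcone k _) _ := ⟨_, line_closed, image_eq⟩
  refine ⟨_, subvariety.union_singleton z_mem, dimension_union (Set.finite_singleton _),
    bijOn_image_compl_zero_union_link hpn hγ, _, _, subvariety, irreducible, ?_,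
    killingForm_weierstrassMatrix_zero_add_link_notMem hpn hγ, rfl⟩
  simpa only [Set.union_empty] using dimension_union Set.finite_empty

end WeierstrassSection

end IndexOne

end

theorem lemma10p2_general (k : Type*) [Field k] [CharZero k] (n p : ℕ)
    (hp : 1 ≤ p) (hpn : p < n) (hcop : Nat.Coprime p n) (πp πm : Set ℕ)
    (hπp : πp = IndexOne.simpleRoots n) (hπm : πm = IndexOne.simpleRoots n \ {p}) :
    (∃! γ : Fin n × Fin n, IndexOne.IsExceptional πp πm γ) ∧
    ∀ γ : Fin n × Fin n, IndexOne.IsExceptional πp πm γ →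
      ∃ Z : Set (Module.Dual k (LieAlgebra.SpecialLinear.sl (Fin n) k)),
        IndexOne.IsSubvariety k _ (IndexOne.regNullcone k _) Z ∧
        IndexOne.dimension k _ Z = 1 ∧
        Set.BijOn (IndexOne.restriction k n πp πm) Z (IndexOne.weierstrassLine k πp πm γ) ∧
        (p ≠ 1 ∧ p ≠ n - 1 → IndexOne.IsIrred k _ Z) ∧
        (p = 1 ∨ p = n - 1 →
          ∃ (C : Set (Module.Dual k (LieAlgebra.SpecialLinear.sl (Fin n) k)))
            (z : Module.Dual k (LieAlgebra.SpecialLinear.sl (Fin n) k)),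
            IndexOne.IsSubvariety k _ (IndexOne.regNullcone k _) C ∧
            IndexOne.IsIrred k _ C ∧ IndexOne.dimension k _ C = 1 ∧
            z ∉ C ∧ Z = C ∪ {z}) := by
  subst hπp hπm
  simp only [IndexOne.isExceptional_iff hpn.le]
  have exceptional := IndexOne.existsUnique_simple_meanderEdge hp hpn hcop
  refine ⟨exceptional, fun γ hγ => ?_⟩
  by_cases hp' : p = 1 ∨ p = n - 1
  · obtain ⟨Z, subvariety, dim_one, bijOn, line_union_point⟩ :=
      IndexOne.exists_line_union_point_over_weierstrass (k := k) (by omega) hp' hγ.1 hγ.2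
        fun δ hδ hsimple => exceptional.unique ⟨hδ, hsimple⟩ hγ
    exact ⟨Z, subvariety, dim_one, bijOn, fun h => absurd hp' (not_or.mpr h),
      fun _ => line_union_point⟩
  · obtain ⟨Z, subvariety, dim_one, bijOn, irreducible⟩ :=
      IndexOne.exists_line_over_weierstrass (k := k) (by omega) (by omega) hcop hγ.1 hγ.2
    exact ⟨Z, subvariety, dim_one, bijOn, fun _ => irreducible, fun h => absurd h hp'⟩

theorem lemma10p2 (k : Type*) [Field k] [IsAlgClosed k] [CharZero k] (n p : ℕ)
    (hp : 1 ≤ p) (hpn : p < n) (hcop : Nat.Coprime p n) (πp πm : Set ℕ)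
    (hπp : πp = IndexOne.simpleRoots n) (hπm : πm = IndexOne.simpleRoots n \ {p}) :
    (∃! γ : Fin n × Fin n, IndexOne.IsExceptional πp πm γ) ∧
    ∀ γ : Fin n × Fin n, IndexOne.IsExceptional πp πm γ →
      ∃ Z : Set (Module.Dual k (LieAlgebra.SpecialLinear.sl (Fin n) k)),
        IndexOne.IsSubvariety k _ (IndexOne.regNullcone k _) Z ∧
        IndexOne.dimension k _ Z = 1 ∧
        Set.BijOn (IndexOne.restriction k n πp πm) Z (IndexOne.weierstrassLine k πp πm γ) ∧
        (p ≠ 1 ∧ p ≠ n - 1 → IndexOne.IsIrred k _ Z) ∧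
        (p = 1 ∨ p = n - 1 →
          ∃ (C : Set (Module.Dual k (LieAlgebra.SpecialLinear.sl (Fin n) k)))
            (z : Module.Dual k (LieAlgebra.SpecialLinear.sl (Fin n) k)),
            IndexOne.IsSubvariety k _ (IndexOne.regNullcone k _) C ∧
            IndexOne.IsIrred k _ C ∧ IndexOne.dimension k _ C = 1 ∧
            z ∉ C ∧ Z = C ∪ {z}) :=
  lemma10p2_general k n p hp hpn hcop πp πm hπp hπm
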